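/- Let $j\in\{1,2\}$ and let $\alpha=(\alpha_n)_{n\in\mathbb Z}$ be a real sequence in $\ell^{1,j}(\mathbb Z)$, i.e. $\sum_{n\in\mathbb Z}|n|^j|\alpha_n|<\infty$. For $\lambda\in\mathbb R$, the Jost solutions $f_\pm(\lambda,\cdot):\mathbb R\to\mathbb C$ are well-defined: each is the unique continuous function that satisfies $-\partial_{xx}f_\pm(\lambda,x)=\lambda^2f_\pm(\lambda,x)$ for $x\in\mathbb R\setminus\mathbb Z$, the jump conditions $\partial_xf_\pm(\lambda,n+)-\partial_xf_\pm(\lambda,n-)=\alpha_nf_\pm(\lambda,n)$ for $n\in\mathbb Z$, and $f_\pm(\lambda,x)\sim e^{\pm i\lambda x}$ as $x\to\pm\infty$. Put $m_\pm(\lambda,x)=e^{\mp i\lambda x}f_\pm(\lambda,x)$. For $x\in\mathbb R$, the function $\lambda\mapsto m_\pm(\lambda,x)-1$ on $\mathbb R$ defines a tempered distribution; let $T^\pm_x=\mathcal F(m_\pm(\cdot,x)-1)$ be its Fourier transform in $\lambda$ as a tempered distribution in $\xi$, with the convention $\mathcal F(f)(\xi)=\int f(\lambda)e^{-2\pi i\lambda\xi}\,d\lambda$.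 For a tempered distribution $T$ on $\mathbb R$ let $\|T\|_{\mathcal M}=|\mu|(\mathbb R)$ be the total variation norm if $T$ is given by a complex Borel measure $\mu$, and $\|T\|_{\mathcal M}=\infty$ otherwise. Then, for each choice of sign, $$\sup_{\pm x\ge0}\|\xi^{j-1}T^\pm_x\|_{\mathcal M}<\infty,\qquad \sup_{\pm x\ge0}\|\xi^{j-1}\partial_xT^\pm_x\|_{\mathcal M}<\infty,\qquad \sup_{\pm x\ge0}\|\xi^{j-1}\partial_\xi T^\pm_x\|_{\mathcal M}<\infty.$$ Furthermore, for every smooth compactly supported function $\tilde\chi:\mathbb R\to\mathbb C$, $$\sup_{\pm x\ge0}\|\xi^{j-1}(\mathcal F(\tilde\chi)*T^\pm_x)\|_{\mathcal M}<\infty,\qquad \sup_{\pm x\ge0}\|\xi^{j-1}\partial_x(\mathcal F(\tilde\chi)*T^\pm_x)\|_{\mathcal M}<\infty,\qquad \sup_{\pm x\ge0}\|\xi^{j-1}\partial_\xi(\mathcal F(\tilde\chi)*T^\pm_x)\|_{\mathcal M}<\infty.$$ Here $\partial_\xi$ is the distributional derivative, and $\partial_x$ is the derivative in the parameter $x$ in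 the sense of tempered distributions: after pairing with any Schwartz function, the left and right derivatives in $x$ exist at every $x$ with $\pm x\ge0$ and are given by tempered distributions, these coincide if $x\notin\mathbb Z$, and the bounds on $\partial_x$ hold for both. -/

import Mathlib

open MeasureTheory Filter Topology SchwartzMap FourierTransform
open scoped ENNReal ContDiff

namespace DeltaArray

/-- Membership in the weighted space `ℓ^{1,s}(ℤ)`: the sequence `|n|^s |v n|` is summable. -/
def MemWeightedL1 (s : ℝ) (v : ℤ → ℝ) : Prop :=
  Summable fun n : ℤ => |(n : ℝ)| ^ s * |v n|

/-- `f` is the Jost solution at spectral parameter `z` for the array of delta interactions of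
strengths `α` placed at the integers. The sign `ε` is `1` for `f₊` and `-1` for `f₋`. -/
structure IsJostSolution (α : ℤ → ℝ) (ε : ℝ) (z : ℂ) (f : ℝ → ℂ) : Prop where
  /-- Continuity across the integers (elsewhere it follows from the next field). -/
  continuous : Continuous f
  differentiableAt : ∀ x : ℝ, x ∉ Set.range ((↑) : ℤ → ℝ) → DifferentiableAt ℝ f x
  /-- `-f'' = z² f` away from the integers. -/
  equation : ∀ x : ℝ, x ∉ Set.range ((↑) : ℤ → ℝ) → HasDerivAt (deriv f) (-(z ^ 2 * f x)) x
  /-- `f'(n+) - f'(n-) = α n * f n` at every integer `n`. -/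
  jump : ∀ n : ℤ, ∃ dl dr : ℂ, Tendsto (deriv f) (𝓝[<] (n : ℝ)) (𝓝 dl) ∧
    Tendsto (deriv f) (𝓝[>] (n : ℝ)) (𝓝 dr) ∧ dr - dl = α n * f n
  /-- `f x ∼ exp (i ε z x)` as `ε x → +∞`. -/
  asymptotic : Asymptotics.IsEquivalent (comap (fun x : ℝ => ε * x) atTop) f
    (fun x : ℝ => Complex.exp (Complex.I * ε * z * x))

/-- The Jost solution `f_ε(z, ·)`. -/
noncomputable def jost (α : ℤ → ℝ) (ε : ℝ) (z : ℂ) : ℝ → ℂ :=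
  Classical.epsilon (IsJostSolution α ε z)

/-- The normalized Jost solution `m_ε(z, x) = exp (-i ε z x) f_ε(z, x)`. -/
noncomputable def mJost (α : ℤ → ℝ) (ε : ℝ) (z : ℂ) (x : ℝ) : ℂ :=
  Complex.exp (-(Complex.I * ε * z * x)) * jost α ε z x

/-- The tempered distribution `U` is the one given by the function `u`. -/
def IsGivenBy (U : 𝓢'(ℝ, ℂ)) (u : ℝ → ℂ) : Prop :=
  ∀ φ : 𝓢(ℝ, ℂ), Integrable (fun t => u t * φ t) ∧ U φ = ∫ t, u t * φ t

/-- The tempered distribution `T` is the one given by the complex Borel measure `μ`. -/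
def IsGivenByMeasure (T : 𝓢'(ℝ, ℂ)) (μ : ComplexMeasure ℝ) : Prop :=
  ∀ φ : 𝓢(ℝ, ℂ), T φ = VectorMeasure.integral μ (fun t => φ t) (ContinuousLinearMap.mul ℝ ℂ)

/-- The total variation norm of a tempered distribution: it is `|μ|(ℝ)` if the distribution is
given by a complex measure `μ`, and `∞` if it is not given by a complex measure. -/
noncomputable def tvNorm (T : 𝓢'(ℝ, ℂ)) : ℝ≥0∞ :=
  ⨅ (μ : ComplexMeasure ℝ) (_ : IsGivenByMeasure T μ), μ.variation Set.univ

/-- The product `ξ^k T`. -/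
noncomputable def mulPow (k : ℕ) (T : 𝓢'(ℝ, ℂ)) : 𝓢'(ℝ, ℂ) :=
  TemperedDistribution.smulLeftCLM ℂ (fun ξ : ℝ => (ξ : ℂ) ^ k) T

/-- The reflection `ξ ↦ g (-ξ)` of a Schwartz function. -/
noncomputable def reflect (g : 𝓢(ℝ, ℂ)) : 𝓢(ℝ, ℂ) :=
  SchwartzMap.compCLMOfContinuousLinearEquiv ℂ (ContinuousLinearEquiv.neg ℝ) g

/-- The convolution `g ∗ T` of a Schwartz function and a tempered distribution, that is,
`⟨g ∗ T, φ⟩ = ⟨T, g(-·) ∗ φ⟩`. -/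
noncomputable def conv (g : 𝓢(ℝ, ℂ)) (T : 𝓢'(ℝ, ℂ)) : 𝓢'(ℝ, ℂ) :=
  PointwiseConvergenceCLM.precomp ℂ
    (SchwartzMap.convolution (ContinuousLinearMap.mul ℂ ℂ) (reflect g)) T

/-- `D` is the derivative at `x`, within `s`, of the family `y ↦ T y` of tempered distributions
(for `s = Set.Iic x` the left derivative, for `s = Set.Ici x` the right derivative). -/
def HasParamDerivWithin (T : ℝ → 𝓢'(ℝ, ℂ)) (D : 𝓢'(ℝ, ℂ)) (s : Set ℝ) (x : ℝ) : Prop :=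
  ∀ φ : 𝓢(ℝ, ℂ), HasDerivWithinAt (fun y => T y φ) (D φ) s x

/-- `sup_{ε x ≥ 0} ‖ξ^k T_x‖ < ∞`. -/
def BoundedTV (ε : ℝ) (k : ℕ) (T : ℝ → 𝓢'(ℝ, ℂ)) : Prop :=
  (⨆ x ∈ {x : ℝ | 0 ≤ ε * x}, tvNorm (mulPow k (T x))) < ⊤

/-- `sup_{ε x ≥ 0} ‖ξ^k ∂_x T_x‖ < ∞`. Both one-sided derivatives in `x` exist at every `x` with
`ε x ≥ 0`, they agree unless `x` is an integer, and both satisfy the bound. -/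
def BoundedTVDerivParam (ε : ℝ) (k : ℕ) (T : ℝ → 𝓢'(ℝ, ℂ)) : Prop :=
  ∃ Dl Dr : ℝ → 𝓢'(ℝ, ℂ),
    (∀ x : ℝ, 0 ≤ ε * x → HasParamDerivWithin T (Dl x) (Set.Iic x) x ∧
      HasParamDerivWithin T (Dr x) (Set.Ici x) x) ∧
    (∀ x : ℝ, 0 ≤ ε * x → x ∉ Set.range ((↑) : ℤ → ℝ) → Dl x = Dr x) ∧
    BoundedTV ε k Dl ∧ BoundedTV ε k Dr

/-- `sup_{ε x ≥ 0} ‖ξ^k ∂_ξ T_x‖ < ∞`, with the distributional derivative in `ξ`. -/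
def BoundedTVDeriv (ε : ℝ) (k : ℕ) (T : ℝ → 𝓢'(ℝ, ℂ)) : Prop :=
  BoundedTV ε k fun x => TemperedDistribution.derivCLM ℂ (T x)

end DeltaArray

/-! On the line, `m₊` solves the Volterra equation `m(λ,x) = 1 + ∑_{n>x} αₙ (∫₀^{n-x} e^{2iλu} du)
m(λ,n)`. With `u = πr` the kernel is the inverse Fourier transform of `π 1_{(0,(n-x)/π]}`, so the
Fourier transform `μ_x` of `m₊(·,x)` satisfies `μ_x = δ₀ + ∑_{n>x} παₙ 1_{(0,(n-x)/π]} ∗ μ_n`, an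
equation between measures (`scattered_eq`). Its Born series is summed in the norm `∫ (1+|ξ|)^p
d|μ|`, `p = j - 1`, which is submultiplicative under convolution (`mass_mix_le`). A discrete
Gronwall argument (`sum_mass_bornTerm_le`) bounds the sum by `exp(∑ |αₙ|(n-x)₊(1+(n-x)₊)^p)`, which
is antitone in `x`, hence uniform over `x ≥ 0`.

Differentiating the indicator in `x` gives a point mass at `(n-x)/π`, and in `ξ` the difference of
point masses at `0` and `(n-x)/π`. Both derivatives of `μ_x` are therefore sums of translates of the
`μ_n` (`hasDerivAt_tsum_tail`, `derivCLM_toDistribution_scattered`), bounded by `mass_shiftSum_le`.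

Pairing `μ_x` with characters produces a Jost solution (`isJostSolution_exp_mul_mFun`), and a
Wronskian argument shows that it is the only one (`IsJostSolution.unique`). Convolution with a
Schwartz function preserves all bounds, and `f₋` reduces to `f₊` by the reflection `x ↦ -x`.

Complex measures are encoded by positive measures on `ℝ × ℂ` (position, complex weight). Infinite
sums and convolutions then exist unconditionally, and finiteness is checked afterwards through
`mass`. -/

namespace DeltaArray

/-! ### Total variation of complex measures with a density -/

theorem integrable_mul_of_withDensity_enorm {Ω : Type*} [MeasurableSpace Ω] {P : Measure Ω}
    {h : Ω → ℂ} (hm : Measurable h) {g : Ω → ℂ}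
    (hg : Integrable g (P.withDensity fun x => ‖h x‖ₑ)) : Integrable (fun x => g x * h x) P := by
  rw [integrable_withDensity_iff_integrable_smul' hm.enorm (by simp)] at hg
  -- Multiplying `‖h‖ g` by the bounded phase `h / ‖h‖`, which is `0` where `h` vanishes, recovers
  -- `g h`.
  have := hg.mul_bdd (c := 1) (g := fun x => (‖h x‖⁻¹ : ℂ) * h x)
    (by fun_prop) (Eventually.of_forall fun x => by simp [inv_mul_le_one])
  refine this.congr (Eventually.of_forall fun x => ?_)
  by_cases hx : h x = 0
  · simp [hx]
  · have : (‖h x‖ : ℂ) ≠ 0 := by simpa using hx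
    simp only [toReal_enorm, Complex.real_smul]
    field_simp

theorem norm_integral_mul_le_withDensity_enorm {Ω : Type*} [MeasurableSpace Ω] {P : Measure Ω}
    {h : Ω → ℂ} (hm : Measurable h) (g : Ω → ℂ) :
    ‖∫ x, g x * h x ∂P‖ ≤ ∫ x, ‖g x‖ ∂(P.withDensity fun x => ‖h x‖ₑ) := by
  refine (norm_integral_le_integral_norm _).trans_eq ?_
  rw [integral_withDensity_eq_integral_toReal_smul hm.enorm (by simp)]
  simp [mul_comm]

/-- Integration against a complex measure with a density. -/
theorem integral_withDensityᵥ_mul {Ω : Type*} [MeasurableSpace Ω] {P : Measure Ω} {h : Ω → ℂ}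
    (hm : Measurable h) (hh : Integrable h P) {f : Ω → ℂ}
    (hf : Integrable f (P.withDensity fun x => ‖h x‖ₑ)) :
    VectorMeasure.integral (P.withDensityᵥ h) f (ContinuousLinearMap.mul ℝ ℂ) =
      ∫ x, f x * h x ∂P := by
  have hv : (P.withDensityᵥ h).variation = P.withDensity fun x => ‖h x‖ₑ :=
    Measure.variation_withDensityᵥ hh
  rw [← hv] at hf
  -- Density of simple functions in `L¹` of the variation: both sides are linear and continuous for
  -- that norm.
  refine Integrable.induction (μ := (P.withDensityᵥ h).variation) (fun f : Ω → ℂ =>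
    VectorMeasure.integral (P.withDensityᵥ h) f (ContinuousLinearMap.mul ℝ ℂ) =
      ∫ x, f x * h x ∂P) ?_ ?_ ?_ ?_ hf
  · intro c s hs hfin
    have hsi : (fun x => (s.indicator (fun _ => c) x) * h x) = s.indicator fun x => c * h x := by
      ext x; by_cases hx : x ∈ s <;> simp [hx]
    rw [hsi, integral_indicator hs, integral_const_mul, VectorMeasure.integral_eq_setToFun,
      setToFun_indicator_const _ hs hfin.ne, transpose_eq_cbmApplyMeasure,
      cbmApplyMeasure_apply, withDensityᵥ_apply hh hs]
    simp
  · intro f g _ hf hg hfe hge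
    rw [VectorMeasure.integral_add hf hg, hfe, hge, ← integral_add]
    · simp [add_mul]
    · exact integrable_mul_of_withDensity_enorm hm (hv ▸ hf)
    · exact integrable_mul_of_withDensity_enorm hm (hv ▸ hg)
  · refine isClosed_eq VectorMeasure.continuous_integral ?_
    refine LipschitzWith.continuous (K := 1) (LipschitzWith.of_dist_le_mul fun f g => ?_)
    have hfi := integrable_mul_of_withDensity_enorm hm (by rw [← hv]; exact L1.integrable_coeFn f)
    have hgi := integrable_mul_of_withDensity_enorm hm (by rw [← hv]; exact L1.integrable_coeFn g)
    rw [dist_eq_norm, ← integral_sub hfi hgi]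
    simp_rw [← sub_mul]
    refine (norm_integral_mul_le_withDensity_enorm hm _).trans_eq ?_
    rw [dist_eq_norm, L1.norm_eq_integral_norm, ← hv, NNReal.coe_one, one_mul]
    refine integral_congr_ae ?_
    filter_upwards [Lp.coeFn_sub f g] with x hx
    rw [hx, Pi.sub_apply]
  · intro f g hfg hf hfe
    rw [← VectorMeasure.integral_congr_ae hfg, hfe]
    rw [hv] at hfg
    rw [Filter.EventuallyEq, ae_withDensity_iff hm.enorm] at hfg
    refine integral_congr_ae ?_
    filter_upwards [hfg] with x hx
    by_cases h0 : h x = 0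
    · simp [h0]
    · rw [hx (by simpa using h0)]

/-- A tempered distribution given by integrating over a measure space has a total variation norm
controlled by the integral of the weight. -/
theorem tvNorm_le_of_eq_integral {Ω : Type*} [MeasurableSpace Ω] {P : Measure Ω} {h : Ω → ℂ}
    {X : Ω → ℝ} (hm : Measurable h) (hX : Measurable X) (hh : Integrable h P) {T : 𝓢'(ℝ, ℂ)}
    (hT : ∀ φ : 𝓢(ℝ, ℂ), T φ = ∫ o, h o * φ (X o) ∂P) : tvNorm T ≤ ∫⁻ o, ‖h o‖ₑ ∂P := by
  have hv : (P.withDensityᵥ h).variation = P.withDensity fun x => ‖h x‖ₑ :=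
    Measure.variation_withDensityᵥ hh
  have hfin : IsFiniteMeasure (P.withDensity fun x => ‖h x‖ₑ) := ⟨by
    rw [withDensity_apply _ MeasurableSet.univ, Measure.restrict_univ]
    exact hh.2⟩
  have hint : ∀ φ : 𝓢(ℝ, ℂ), Integrable (fun o => φ (X o)) (P.withDensity fun x => ‖h x‖ₑ) := by
    intro φ
    refine Integrable.of_bound (C := SchwartzMap.seminorm ℝ 0 0 φ)
      ((φ.continuous.measurable.comp hX).aestronglyMeasurable)
      (Eventually.of_forall fun o => norm_le_seminorm ℝ φ _)
  -- The representing measure is the pushforward of `h P` under `X`; a pushforward does not increase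
  -- the variation.
  have hg : IsGivenByMeasure T ((P.withDensityᵥ h).map X) := by
    intro φ
    rw [VectorMeasure.integral_map hX φ.continuous.aestronglyMeasurable,
      integral_withDensityᵥ_mul hm hh (hint φ), hT]
    · simp [mul_comm]
    · rw [VectorMeasure.Integrable, hv]
      exact hint φ
  refine (iInf₂_le _ hg).trans ?_
  refine (VectorMeasure.variation_map_le _).trans ?_
  rw [Measure.map_apply hX MeasurableSet.univ, hv, Set.preimage_univ,
    withDensity_apply _ MeasurableSet.univ, Measure.restrict_univ]

/-! ### Complex measures encoded on `ℝ × ℂ`: pairing, weighted mass, convolution -/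

/-- A positive measure `P` on `ℝ × ℂ` encodes the complex measure `φ ↦ ∫ w * φ s ∂P(s, w)`. -/
noncomputable def pairing (P : Measure (ℝ × ℂ)) (φ : ℝ → ℂ) : ℂ := ∫ q, q.2 * φ q.1 ∂P

/-- The weighted mass `∫ |w| (1 + |s|)^p ∂P(s, w)`. -/
noncomputable def mass (p : ℕ) (P : Measure (ℝ × ℂ)) : ℝ≥0∞ :=
  ∫⁻ q, ‖q.2‖ₑ * (1 + ‖q.1‖ₑ) ^ p ∂P

/-- The average, with respect to `g • Q`, of the translates of the complex measure encoded
by `P`. -/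
noncomputable def mix (Q : Measure ℝ) (g : ℝ → ℂ) (P : Measure (ℝ × ℂ)) : Measure (ℝ × ℂ) :=
  (Q.prod P).map fun z => (z.1 + z.2.1, g z.1 * z.2.2)

instance (Q : Measure ℝ) (g : ℝ → ℂ) (P : Measure (ℝ × ℂ)) [SFinite Q] [SFinite P] :
    SFinite (mix Q g P) := by
  unfold mix; infer_instance

theorem measurable_mix_map {g : ℝ → ℂ} (hg : Measurable g) :
    Measurable fun z : ℝ × (ℝ × ℂ) => (z.1 + z.2.1, g z.1 * z.2.2) := by
  fun_prop

theorem measurable_mass_integrand (p : ℕ) :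
    Measurable fun q : ℝ × ℂ => ‖q.2‖ₑ * (1 + ‖q.1‖ₑ) ^ p := by
  fun_prop

theorem lintegral_enorm_le_mass (p : ℕ) (P : Measure (ℝ × ℂ)) :
    ∫⁻ q, ‖q.2‖ₑ ∂P ≤ mass p P := by
  refine lintegral_mono fun q => ?_
  exact le_mul_of_one_le_right' (one_le_pow₀ (by simp))

theorem integrable_snd_of_mass {p : ℕ} {P : Measure (ℝ × ℂ)} (h : mass p P ≠ ⊤) :
    Integrable (fun q : ℝ × ℂ => q.2) P :=
  ⟨measurable_snd.aestronglyMeasurable,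
    (lintegral_enorm_le_mass p P).trans_lt (lt_top_iff_ne_top.2 h)⟩

theorem integrable_pairing {p : ℕ} {P : Measure (ℝ × ℂ)} (h : mass p P ≠ ⊤) {φ : ℝ → ℂ}
    (hφ : Measurable φ) {C : ℝ} (hC : ∀ s, ‖φ s‖ ≤ C) :
    Integrable (fun q : ℝ × ℂ => q.2 * φ q.1) P :=
  (integrable_snd_of_mass h).mul_bdd (c := C) (hφ.comp measurable_fst).aestronglyMeasurable
    (Eventually.of_forall fun _ => hC _)

theorem norm_pairing_le {p : ℕ} {P : Measure (ℝ × ℂ)} (h : mass p P ≠ ⊤) {φ : ℝ → ℂ}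
    {C : ℝ} (hC : ∀ s, ‖φ s‖ ≤ C) : ‖pairing P φ‖ ≤ C * (mass p P).toReal := by
  have hC0 : 0 ≤ C := (norm_nonneg _).trans (hC 0)
  calc ‖pairing P φ‖ ≤ ∫ q : ℝ × ℂ, C * ‖q.2‖ ∂P := by
        refine norm_integral_le_of_norm_le ((integrable_snd_of_mass h).norm.const_mul C)
          (Eventually.of_forall fun q => ?_)
        rw [norm_mul, mul_comm]
        exact mul_le_mul_of_nonneg_right (hC _) (norm_nonneg _)
    _ = C * (∫⁻ q : ℝ × ℂ, ‖q.2‖ₑ ∂P).toReal := by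
        rw [integral_const_mul, integral_norm_eq_lintegral_enorm
          measurable_snd.aestronglyMeasurable]
    _ ≤ _ := by
        gcongr
        exact lintegral_enorm_le_mass p P

/-- A weighted Young inequality. It rests on `1 + |r + s| ≤ (1 + |r|)(1 + |s|)`, the reason for
using the weight `(1 + |ξ|)^p` in place of `|ξ|^p`. -/
theorem mass_mix_le (p : ℕ) {Q : Measure ℝ} {g : ℝ → ℂ} (hg : Measurable g)
    (P : Measure (ℝ × ℂ)) [SFinite Q] [SFinite P] :
    mass p (mix Q g P) ≤ (∫⁻ r, ‖g r‖ₑ * (1 + ‖r‖ₑ) ^ p ∂Q) * mass p P := by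
  unfold mix mass
  rw [lintegral_map (measurable_mass_integrand p) (measurable_mix_map hg),
    ← lintegral_prod_mul (by fun_prop) (by fun_prop)]
  refine lintegral_mono fun z => ?_
  dsimp only
  calc ‖g z.1 * z.2.2‖ₑ * (1 + ‖z.1 + z.2.1‖ₑ) ^ p
      ≤ (‖g z.1‖ₑ * ‖z.2.2‖ₑ) * ((1 + ‖z.1‖ₑ) * (1 + ‖z.2.1‖ₑ)) ^ p := by
        rw [enorm_mul]
        gcongr
        calc 1 + ‖z.1 + z.2.1‖ₑ ≤ 1 + (‖z.1‖ₑ + ‖z.2.1‖ₑ) := by gcongr; exact enorm_add_le _ _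
          _ ≤ 1 + (‖z.1‖ₑ + ‖z.2.1‖ₑ) + ‖z.1‖ₑ * ‖z.2.1‖ₑ := le_self_add
          _ = _ := by ring
    _ = _ := by rw [mul_pow]; ring

theorem integrable_mix_integrand {p : ℕ} {Q : Measure ℝ} {g : ℝ → ℂ}
    (hgi : Integrable g Q) {P : Measure (ℝ × ℂ)} [SFinite Q] [SFinite P] (h : mass p P ≠ ⊤)
    {φ : ℝ → ℂ} (hφ : Measurable φ) {C : ℝ} (hC : ∀ s, ‖φ s‖ ≤ C) :
    Integrable (fun z : ℝ × (ℝ × ℂ) => (g z.1 * z.2.2) * φ (z.1 + z.2.1)) (Q.prod P) :=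
  (hgi.mul_prod (integrable_snd_of_mass h)).mul_bdd (c := C)
    (Measurable.aestronglyMeasurable (by fun_prop)) (Eventually.of_forall fun _ => hC _)

theorem pairing_mix {p : ℕ} {Q : Measure ℝ} {g : ℝ → ℂ} (hg : Measurable g)
    (hgi : Integrable g Q) {P : Measure (ℝ × ℂ)} [SFinite Q] [SFinite P] (h : mass p P ≠ ⊤)
    {φ : ℝ → ℂ} (hφ : Measurable φ) {C : ℝ} (hC : ∀ s, ‖φ s‖ ≤ C) :
    pairing (mix Q g P) φ = ∫ r, g r * pairing P (fun s => φ (r + s)) ∂Q := by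
  unfold pairing mix
  rw [integral_map (measurable_mix_map hg).aemeasurable
      (Measurable.aestronglyMeasurable (by fun_prop)),
    integral_prod _ (integrable_mix_integrand hgi h hφ hC)]
  refine integral_congr_ae (Eventually.of_forall fun r => ?_)
  simp only [mul_assoc]
  rw [integral_const_mul]

/-- Fubini in the other order. For Lebesgue `Q` the inner integral is the test function convolved
with the reflection of `g`, as in the definition of `conv`. -/
theorem pairing_mix_swap {p : ℕ} {Q : Measure ℝ} {g : ℝ → ℂ} (hg : Measurable g)
    (hgi : Integrable g Q) {P : Measure (ℝ × ℂ)} [SFinite Q] [SFinite P] (h : mass p P ≠ ⊤)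
    {φ : ℝ → ℂ} (hφ : Measurable φ) {C : ℝ} (hC : ∀ s, ‖φ s‖ ≤ C) :
    pairing (mix Q g P) φ = pairing P fun s => ∫ r, g r * φ (r + s) ∂Q := by
  unfold pairing mix
  rw [integral_map (measurable_mix_map hg).aemeasurable
      (Measurable.aestronglyMeasurable (by fun_prop)),
    integral_prod_symm _ (integrable_mix_integrand hgi h hφ hC)]
  refine integral_congr_ae (Eventually.of_forall fun q => ?_)
  dsimp only
  rw [← integral_const_mul]
  refine integral_congr_ae (Eventually.of_forall fun r => ?_)
  dsimp only
  ring

theorem mass_sum (p : ℕ) {ι : Type*} (P : ι → Measure (ℝ × ℂ)) :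
    mass p (Measure.sum P) = ∑' i, mass p (P i) :=
  lintegral_sum_measure _ _

theorem mass_add (p : ℕ) (P P' : Measure (ℝ × ℂ)) : mass p (P + P') = mass p P + mass p P' :=
  lintegral_add_measure _ _ _

theorem hasSum_pairing {p : ℕ} {ι : Type*} [Countable ι] {P : ι → Measure (ℝ × ℂ)}
    (h : mass p (Measure.sum P) ≠ ⊤) {φ : ℝ → ℂ} (hφ : Measurable φ) {C : ℝ}
    (hC : ∀ s, ‖φ s‖ ≤ C) :
    HasSum (fun i => pairing (P i) φ) (pairing (Measure.sum P) φ) :=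
  hasSum_integral_measure (integrable_pairing h hφ hC)

theorem pairing_add {p : ℕ} {P P' : Measure (ℝ × ℂ)} (h : mass p P ≠ ⊤) (h' : mass p P' ≠ ⊤)
    {φ : ℝ → ℂ} (hφ : Measurable φ) {C : ℝ} (hC : ∀ s, ‖φ s‖ ≤ C) :
    pairing (P + P') φ = pairing P φ + pairing P' φ :=
  integral_add_measure (integrable_pairing h hφ hC) (integrable_pairing h' hφ hC)

theorem mass_dirac (p : ℕ) : mass p (Measure.dirac ((0 : ℝ), (1 : ℂ))) = 1 := by
  simp [mass]

theorem pairing_dirac (φ : ℝ → ℂ) : pairing (Measure.dirac ((0 : ℝ), (1 : ℂ))) φ = φ 0 := by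
  simp [pairing]

theorem mix_sum {ι : Type*} [Countable ι] (Q : Measure ℝ) [SFinite Q] {g : ℝ → ℂ}
    (hg : Measurable g) (P : ι → Measure (ℝ × ℂ)) [∀ i, SFinite (P i)] :
    mix Q g (Measure.sum P) = Measure.sum fun i => mix Q g (P i) := by
  unfold mix
  rw [Measure.prod_sum_right, Measure.map_sum (measurable_mix_map hg).aemeasurable]

/-! ### Tempered distributions with weighted representing measures, and convolution -/

/-- The tempered distribution encoded by `P`. -/
theorem exists_distribution {p : ℕ} {P : Measure (ℝ × ℂ)} (h : mass p P ≠ ⊤) :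
    ∃ T : 𝓢'(ℝ, ℂ), ∀ φ : 𝓢(ℝ, ℂ), T φ = pairing P φ := by
  have hb : ∀ φ : 𝓢(ℝ, ℂ), ∀ s, ‖φ s‖ ≤ SchwartzMap.seminorm ℂ 0 0 φ := fun φ s =>
    norm_le_seminorm ℂ φ s
  have hi := fun φ : 𝓢(ℝ, ℂ) => integrable_pairing h φ.continuous.measurable (hb φ)
  let A : 𝓢(ℝ, ℂ) →L[ℂ] ℂ := SchwartzMap.mkCLMtoNormedSpace (fun φ => pairing P φ)
    (fun φ ψ => by
      simp only [pairing]
      rw [← integral_add (hi φ) (hi ψ)]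
      simp [mul_add])
    (fun c φ => by
      simp only [pairing]
      rw [RingHom.id_apply, smul_eq_mul, ← integral_const_mul]
      congr 1; ext q; simp; ring)
    ⟨{(0, 0)}, (mass p P).toReal, ENNReal.toReal_nonneg, fun φ => by
      rw [mul_comm]
      simpa [schwartzSeminormFamily] using norm_pairing_le h (hb φ)⟩
  exact ⟨A.toPointwiseConvergenceCLM _ _ _ _, fun φ => rfl⟩

/-- The tempered distribution `T` is given by a complex measure whose total variation with the
weight `(1 + |ξ|)^p` is at most `C`. -/
def HasRep (p : ℕ) (C : ℝ≥0∞) (T : 𝓢'(ℝ, ℂ)) : Prop :=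
  ∃ P : Measure (ℝ × ℂ), SFinite P ∧ mass p P ≤ C ∧ ∀ φ : 𝓢(ℝ, ℂ), T φ = pairing P φ

theorem HasRep.mono {p : ℕ} {C C' : ℝ≥0∞} {T : 𝓢'(ℝ, ℂ)} (h : HasRep p C T) (hC : C ≤ C') :
    HasRep p C' T := by
  obtain ⟨P, hs, hm, hT⟩ := h
  exact ⟨P, hs, hm.trans hC, hT⟩

theorem HasRep.add {p : ℕ} {C C' : ℝ≥0∞} {T T' : 𝓢'(ℝ, ℂ)} (h : HasRep p C T)
    (h' : HasRep p C' T') (hC : C ≠ ⊤) (hC' : C' ≠ ⊤) : HasRep p (C + C') (T + T') := by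
  obtain ⟨P, hs, hm, hT⟩ := h
  obtain ⟨P', hs', hm', hT'⟩ := h'
  refine ⟨P + P', inferInstance, (mass_add p P P').trans_le (add_le_add hm hm'), fun φ => ?_⟩
  rw [pairing_add (ne_top_of_le_ne_top hC hm) (ne_top_of_le_ne_top hC' hm')
    φ.continuous.measurable (fun s => norm_le_seminorm ℂ φ s), ← hT, ← hT']
  rfl

theorem HasRep.tvNorm_mulPow_le {p : ℕ} {C : ℝ≥0∞} {T : 𝓢'(ℝ, ℂ)} (h : HasRep p C T)
    (hC : C ≠ ⊤) : tvNorm (mulPow p T) ≤ C := by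
  obtain ⟨P, hs, hm, hT⟩ := h
  have hle : ∫⁻ q : ℝ × ℂ, ‖q.2 * (q.1 : ℂ) ^ p‖ₑ ∂P ≤ mass p P := by
    refine lintegral_mono fun q => ?_
    rw [enorm_mul, enorm_pow]
    gcongr
    refine le_trans (le_of_eq ?_) le_add_self
    simp [← ofReal_norm]
  refine (tvNorm_le_of_eq_integral (h := fun q : ℝ × ℂ => q.2 * (q.1 : ℂ) ^ p)
    (X := fun q => q.1) (by fun_prop) (by fun_prop)
    ⟨Measurable.aestronglyMeasurable (by fun_prop), ?_⟩ fun φ => ?_).trans (hle.trans hm)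
  · exact (hle.trans hm).trans_lt (lt_top_iff_ne_top.2 hC)
  · rw [mulPow, TemperedDistribution.smulLeftCLM_apply_apply, hT]
    refine integral_congr_ae (Eventually.of_forall fun q => ?_)
    dsimp only
    rw [SchwartzMap.smulLeftCLM_apply_apply (by fun_prop), smul_eq_mul, mul_assoc]

theorem conv_apply (g : 𝓢(ℝ, ℂ)) (T : 𝓢'(ℝ, ℂ)) (φ : 𝓢(ℝ, ℂ)) :
    conv g T φ = T (SchwartzMap.convolution (ContinuousLinearMap.mul ℂ ℂ) (reflect g) φ) :=
  rfl

theorem convolution_reflect_apply (g φ : 𝓢(ℝ, ℂ)) (s : ℝ) :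
    SchwartzMap.convolution (ContinuousLinearMap.mul ℂ ℂ) (reflect g) φ s =
      ∫ r, g r * φ (r + s) := by
  rw [SchwartzMap.convolution_apply, MeasureTheory.convolution,
    ← integral_neg_eq_self (fun r => g r * φ (r + s))]
  refine integral_congr_ae (Eventually.of_forall fun r => ?_)
  simp [reflect, sub_eq_neg_add]

/-- The `L¹` norm of a Schwartz function with the weight `(1 + |ξ|)^p`. -/
noncomputable def weightedNorm (p : ℕ) (g : 𝓢(ℝ, ℂ)) : ℝ≥0∞ := ∫⁻ r, ‖g r‖ₑ * (1 + ‖r‖ₑ) ^ p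

theorem weightedNorm_ne_top (p : ℕ) (g : 𝓢(ℝ, ℂ)) : weightedNorm p g ≠ ⊤ := by
  have hi : Integrable fun r : ℝ => g r * ((1 + ‖r‖ : ℝ) ^ p : ℝ) := by
    have hs : Integrable fun r : ℝ =>
        ∑ k ∈ Finset.range (p + 1), ‖r‖ ^ k * ‖g r‖ * (p.choose k : ℝ) :=
      integrable_finsetSum _ fun k _ => (g.integrable_pow_mul volume k).mul_const _
    refine hs.mono' (Continuous.aestronglyMeasurable (by fun_prop))
      (Eventually.of_forall fun r => le_of_eq ?_)
    rw [norm_mul, Complex.norm_real, Real.norm_of_nonneg (by positivity), add_comm, add_pow,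
      Finset.mul_sum]
    refine Finset.sum_congr rfl fun k _ => ?_
    simp only [one_pow, mul_one]
    ring
  refine ne_of_lt (lt_of_le_of_lt (le_of_eq ?_) hi.2)
  refine lintegral_congr fun r => ?_
  rw [enorm_mul]
  congr 1
  rw [← ofReal_norm (E := ℂ), Complex.norm_real, Real.norm_of_nonneg (by positivity),
    ENNReal.ofReal_pow (by positivity), ENNReal.ofReal_add (by positivity) (by positivity),
    ofReal_norm, ENNReal.ofReal_one]

theorem HasRep.conv {p : ℕ} {C : ℝ≥0∞} {T : 𝓢'(ℝ, ℂ)} (h : HasRep p C T) (hC : C ≠ ⊤)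
    (g : 𝓢(ℝ, ℂ)) : HasRep p (weightedNorm p g * C) (conv g T) := by
  obtain ⟨P, hs, hm, hT⟩ := h
  refine ⟨mix volume g P, inferInstance,
    (mass_mix_le p g.continuous.measurable P).trans (mul_le_mul_right hm _), fun φ => ?_⟩
  rw [pairing_mix_swap g.continuous.measurable g.integrable (ne_top_of_le_ne_top hC hm)
    φ.continuous.measurable (fun s => norm_le_seminorm ℂ φ s), conv_apply, hT]
  simp_rw [← convolution_reflect_apply]

/-- Integration by parts puts the derivative on `g`, so the `∂_ξ` bound for a convolution needs only
the bound on `T` itself. -/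
theorem derivCLM_conv (g : 𝓢(ℝ, ℂ)) (T : 𝓢'(ℝ, ℂ)) :
    TemperedDistribution.derivCLM ℂ (DeltaArray.conv g T) =
      DeltaArray.conv (SchwartzMap.derivCLM ℂ ℂ g) T := by
  ext φ
  rw [TemperedDistribution.derivCLM_apply_apply, conv_apply, conv_apply]
  congr 1
  ext s
  rw [map_neg, _root_.neg_apply, convolution_reflect_apply, convolution_reflect_apply]
  have h1 : ∀ r, HasDerivAt (fun r => φ (r + s)) (deriv φ (r + s)) r := fun r =>
    (φ.hasDerivAt (r + s)).comp_add_const r s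
  have hb : ∀ (f : 𝓢(ℝ, ℂ)) (u : 𝓢(ℝ, ℂ)), Integrable fun r => f r * u (r + s) := fun f u =>
    f.integrable.mul_bdd (c := SchwartzMap.seminorm ℂ 0 0 u)
      (Continuous.aestronglyMeasurable (by fun_prop))
      (Eventually.of_forall fun r => norm_le_seminorm ℂ u _)
  have := integral_mul_deriv_eq_deriv_mul_of_integrable (u := g) (u' := deriv g)
    (v := fun r => φ (r + s)) (v' := fun r => deriv φ (r + s)) (fun r _ => g.hasDerivAt r)
    (fun r _ => h1 r) (hb g (SchwartzMap.derivCLM ℂ ℂ φ)) (hb (SchwartzMap.derivCLM ℂ ℂ g) φ)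
    (hb g φ)
  simp [this]

/-! ### The Gronwall majorant -/

/-- The coefficients `|α n| (n - x)₊ (1 + (n - x)₊)^p`. -/
noncomputable def coef (α : ℤ → ℝ) (p : ℕ) (x : ℝ) (n : ℤ) : ℝ :=
  |α n| * (max (n - x) 0 * (1 + max (n - x) 0) ^ p)

/-- The majorant `exp (∑ₙ |α n| (n - x)₊ (1 + (n - x)₊)^p)`. -/
noncomputable def majorant (α : ℤ → ℝ) (p : ℕ) (x : ℝ) : ℝ :=
  Real.exp (∑' n, coef α p x n)

/-- `∑ₙ |α n| (1 + |n|)^(p+1) < ∞`. -/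
def WeightSummable (α : ℤ → ℝ) (p : ℕ) : Prop :=
  Summable fun n : ℤ => |α n| * (1 + |(n : ℝ)|) ^ (p + 1)

theorem coef_nonneg (α : ℤ → ℝ) (p : ℕ) (x : ℝ) (n : ℤ) : 0 ≤ coef α p x n := by
  unfold coef; positivity

theorem coef_anti (α : ℤ → ℝ) (p : ℕ) (n : ℤ) : Antitone fun x => coef α p x n := by
  intro x y hxy
  have : max ((n : ℝ) - y) 0 ≤ max ((n : ℝ) - x) 0 := by gcongr
  have h0 : (0 : ℝ) ≤ max ((n : ℝ) - y) 0 := le_max_right _ _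
  change |α n| * (max ((n : ℝ) - y) 0 * (1 + max ((n : ℝ) - y) 0) ^ p) ≤
    |α n| * (max ((n : ℝ) - x) 0 * (1 + max ((n : ℝ) - x) 0) ^ p)
  gcongr

theorem coef_of_le {α : ℤ → ℝ} {p : ℕ} {x : ℝ} {n : ℤ} (h : (n : ℝ) ≤ x) : coef α p x n = 0 := by
  simp [coef, max_eq_right (sub_nonpos.2 h)]

theorem summable_coef {α : ℤ → ℝ} {p : ℕ} (h : WeightSummable α p) (x : ℝ) :
    Summable (coef α p x) := by
  refine Summable.of_nonneg_of_le (coef_nonneg α p x) (fun n => ?_)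
    (h.mul_left ((1 + |x|) ^ (p + 1)))
  have h1 : max ((n : ℝ) - x) 0 ≤ |(n : ℝ)| + |x| :=
    max_le (by linarith [le_abs_self (n : ℝ), neg_abs_le x]) (by positivity)
  have h2 : 1 + max ((n : ℝ) - x) 0 ≤ (1 + |x|) * (1 + |(n : ℝ)|) := by
    nlinarith [mul_nonneg (abs_nonneg x) (abs_nonneg (n : ℝ))]
  have h0 : (0 : ℝ) ≤ max ((n : ℝ) - x) 0 := le_max_right _ _
  calc coef α p x n ≤ |α n| * ((1 + max ((n : ℝ) - x) 0) * (1 + max ((n : ℝ) - x) 0) ^ p) := by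
        unfold coef; gcongr; linarith
    _ = |α n| * (1 + max ((n : ℝ) - x) 0) ^ (p + 1) := by rw [pow_succ']
    _ ≤ |α n| * ((1 + |x|) * (1 + |(n : ℝ)|)) ^ (p + 1) := by gcongr
    _ = _ := by rw [mul_pow]; ring

theorem majorant_anti {α : ℤ → ℝ} {p : ℕ} (h : WeightSummable α p) :
    Antitone (majorant α p) := fun x y hxy =>
  Real.exp_le_exp.2 ((summable_coef h y).tsum_le_tsum (fun n => coef_anti α p n hxy)
    (summable_coef h x))

theorem majorant_pos (α : ℤ → ℝ) (p : ℕ) (x : ℝ) : 0 < majorant α p x := Real.exp_pos _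

theorem tendsto_majorant {α : ℤ → ℝ} {p : ℕ} (h : WeightSummable α p) :
    Tendsto (majorant α p) atTop (𝓝 1) := by
  have : Tendsto (fun x => ∑' n, coef α p x n) atTop (𝓝 (∑' _ : ℤ, (0 : ℝ))) := by
    refine tendsto_tsum_of_dominated_convergence (summable_coef h 0) (fun n => ?_) ?_
    · refine tendsto_const_nhds.congr' ?_
      filter_upwards [eventually_ge_atTop (n : ℝ)] with x hx
      rw [coef_of_le hx]
    · filter_upwards [eventually_ge_atTop 0] with x hx n
      rw [Real.norm_of_nonneg (coef_nonneg _ _ _ _)]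
      exact coef_anti α p n hx
  simpa [majorant, Function.comp_def] using! (Real.continuous_exp.tendsto _).comp this

/-- Telescoping estimate behind the discrete Gronwall inequality. -/
theorem sum_mul_exp_tail_le {c : ℤ → ℝ} (h0 : ∀ n, 0 ≤ c n) (hc : Summable c) (s : Finset ℤ) :
    ∀ a : ℤ, (∀ n ∈ s, a < n) →
      ∑ n ∈ s, c n * Real.exp (∑' m, (Set.Ioi n).indicator c m) ≤
        Real.exp (∑' m, (Set.Ioi a).indicator c m) - 1 := by
  induction s using Finset.induction_on_min with
  | empty =>
    intro a _
    have : 0 ≤ ∑' m, (Set.Ioi a).indicator c m :=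
      tsum_nonneg fun m => Set.indicator_nonneg (fun n _ => h0 n) m
    simpa using Real.one_le_exp this
  | insert b s hb ih =>
    intro a ha
    have hbs : b ∉ s := fun hmem => lt_irrefl _ (hb b hmem)
    rw [Finset.sum_insert hbs]
    have hab : a < b := ha b (Finset.mem_insert_self _ _)
    have hle : c b + ∑' m, (Set.Ioi b).indicator c m ≤ ∑' m, (Set.Ioi a).indicator c m := by
      have h1 : c b = ∑' m, ({b} : Set ℤ).indicator c m := by
        rw [← tsum_subtype, tsum_singleton]
      rw [h1, ← (hc.indicator _).tsum_add (hc.indicator _)]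
      refine ((hc.indicator _).add (hc.indicator _)).tsum_le_tsum (fun m => ?_) (hc.indicator _)
      rcases lt_trichotomy m b with hm | rfl | hm
      · have : m ≠ b := hm.ne
        simpa [this, hm.le] using Set.indicator_nonneg (fun n _ => h0 n) m
      · simp [hab]
      · simp [hm, hm.ne', hab.trans hm]
    have h2 := ih b hb
    -- From `1 + c b ≤ exp (c b)`; with the induction hypothesis at `a := b` the sum telescopes.
    have h3 : c b * Real.exp (∑' m, (Set.Ioi b).indicator c m) +
        Real.exp (∑' m, (Set.Ioi b).indicator c m) ≤
          Real.exp (∑' m, (Set.Ioi a).indicator c m) := by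
      refine le_trans ?_ (Real.exp_le_exp.2 hle)
      rw [Real.exp_add]
      nlinarith [Real.add_one_le_exp (c b), Real.exp_pos (∑' m, (Set.Ioi b).indicator c m)]
    linarith

/-- The majorant is a supersolution of the Volterra inequality. Only sites `n > x` count, and there
`majorant α p n` is at most the exponential of the coefficients at `x` summed beyond `n`, because
`coef` is antitone in its base point and vanishes at sites `m ≤ n`. The telescoping estimate then
applies. -/
theorem one_add_sum_coef_mul_majorant_le {α : ℤ → ℝ} {p : ℕ} (h : WeightSummable α p) (x : ℝ)
    (s : Finset ℤ) : 1 + ∑ n ∈ s, coef α p x n * majorant α p n ≤ majorant α p x := by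
  obtain ⟨a, ha⟩ : ∃ a : ℤ, ∀ n ∈ s, a < n := by
    obtain ⟨b, hb⟩ := s.bddBelow
    exact ⟨b - 1, fun n hn => by linarith [hb (Finset.mem_coe.2 hn)]⟩
  have hc := summable_coef h x
  have h1 := sum_mul_exp_tail_le (coef_nonneg α p x) hc s a ha
  have h2 : Real.exp (∑' m, (Set.Ioi a).indicator (coef α p x) m) ≤ majorant α p x :=
    Real.exp_le_exp.2 ((hc.indicator _).tsum_le_tsum
      (fun m => Set.indicator_le_self' (fun _ _ => coef_nonneg _ _ _ _) m) hc)
  have h3 : ∑ n ∈ s, coef α p x n * majorant α p n ≤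
      ∑ n ∈ s, coef α p x n * Real.exp (∑' m, (Set.Ioi n).indicator (coef α p x) m) := by
    refine Finset.sum_le_sum fun n _ => ?_
    rcases le_or_gt (n : ℝ) x with hn | hn
    · simp [coef_of_le hn]
    · refine mul_le_mul_of_nonneg_left (Real.exp_le_exp.2 ?_) (coef_nonneg _ _ _ _)
      refine (summable_coef h n).tsum_le_tsum (fun m => ?_) (hc.indicator _)
      rcases le_or_gt m n with hm | hm
      · rw [coef_of_le (by exact_mod_cast hm)]
        exact Set.indicator_nonneg (fun _ _ => coef_nonneg _ _ _ _) m
      · rw [Set.indicator_of_mem (Set.mem_Ioi.2 hm)]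
        exact coef_anti α p m hn.le
  linarith

theorem one_add_tsum_coef_mul_majorant_le {α : ℤ → ℝ} {p : ℕ} (h : WeightSummable α p) (x : ℝ) :
    1 + ∑' n, ENNReal.ofReal (coef α p x n) * ENNReal.ofReal (majorant α p n) ≤
      ENNReal.ofReal (majorant α p x) := by
  rw [ENNReal.tsum_eq_iSup_sum, ENNReal.add_iSup]
  refine iSup_le fun s => ?_
  have : ∑ n ∈ s, ENNReal.ofReal (coef α p x n) * ENNReal.ofReal (majorant α p n) =
      ENNReal.ofReal (∑ n ∈ s, coef α p x n * majorant α p n) := by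
    rw [ENNReal.ofReal_sum_of_nonneg
      fun n _ => mul_nonneg (coef_nonneg _ _ _ _) (majorant_pos _ _ _).le]
    exact Finset.sum_congr rfl fun n _ => (ENNReal.ofReal_mul (coef_nonneg _ _ _ _)).symm
  rw [this, ← ENNReal.ofReal_one, ← ENNReal.ofReal_add zero_le_one]
  · exact ENNReal.ofReal_le_ofReal (one_add_sum_coef_mul_majorant_le h x s)
  · exact Finset.sum_nonneg fun n _ => mul_nonneg (coef_nonneg _ _ _ _) (majorant_pos _ _ _).le

/-! ### The Born series on the Fourier side -/

/-- One scattering event at the site `n`. -/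
noncomputable def smear (α : ℤ → ℝ) (x : ℝ) (n : ℤ) (P : Measure (ℝ × ℂ)) : Measure (ℝ × ℂ) :=
  mix (volume.restrict (Set.Ioc 0 ((n - x) / Real.pi))) (fun _ => ((Real.pi * α n : ℝ) : ℂ)) P

instance (α : ℤ → ℝ) (x : ℝ) (n : ℤ) (P : Measure (ℝ × ℂ)) [SFinite P] :
    SFinite (smear α x n P) := by
  unfold smear; infer_instance

/-- The terms of the Born series of the normalized Jost solution, on the Fourier side. -/
noncomputable def bornTerm (α : ℤ → ℝ) : ℕ → ℝ → Measure (ℝ × ℂ)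
  | 0, _ => Measure.dirac (0, 1)
  | i + 1, x => Measure.sum fun n : ℤ => smear α x n (bornTerm α i n)

instance sFinite_bornTerm (α : ℤ → ℝ) (i : ℕ) (x : ℝ) : SFinite (bornTerm α i x) := by
  induction i generalizing x with
  | zero => unfold bornTerm; infer_instance
  | succ i ih => unfold bornTerm; infer_instance

/-- The Fourier transform of `m₊(·, x)`. -/
noncomputable def jostMeasure (α : ℤ → ℝ) (x : ℝ) : Measure (ℝ × ℂ) :=
  Measure.sum fun i => bornTerm α i x

/-- The Fourier transform of `m₊(·, x) - 1`. -/
noncomputable def scattered (α : ℤ → ℝ) (x : ℝ) : Measure (ℝ × ℂ) :=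
  Measure.sum fun i => bornTerm α (i + 1) x

instance (α : ℤ → ℝ) (x : ℝ) : SFinite (jostMeasure α x) := by
  unfold jostMeasure; infer_instance

instance (α : ℤ → ℝ) (x : ℝ) : SFinite (scattered α x) := by
  unfold scattered; infer_instance

/-- The density `π αₙ` on an interval of length `(n - x)/π` loses its factor `π`. Since `π ≥ 1`, the
interval lies in `(0, n - x]`, which bounds the weight. -/
theorem mass_smear_le (α : ℤ → ℝ) (p : ℕ) (x : ℝ) (n : ℤ) (P : Measure (ℝ × ℂ)) [SFinite P] :
    mass p (smear α x n P) ≤ ENNReal.ofReal (coef α p x n) * mass p P := by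
  refine (mass_mix_le p measurable_const P).trans ?_
  gcongr
  have hpi := Real.pi_pos
  have hpi1 : 1 ≤ Real.pi := by linarith [Real.pi_gt_three]
  set t : ℝ := (n - x) / Real.pi with ht
  have hb : ∀ r ∈ Set.Ioc 0 t, ‖((Real.pi * α n : ℝ) : ℂ)‖ₑ * (1 + ‖r‖ₑ) ^ p ≤
      ENNReal.ofReal (Real.pi * |α n| * (1 + max (n - x) 0) ^ p) := by
    intro r hr
    have hr2 : ‖r‖ ≤ max (n - x) 0 := by
      rw [Real.norm_of_nonneg hr.1.le]
      refine le_max_of_le_left (hr.2.trans ?_)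
      have : 0 < n - x := by
        have := hr.1.trans_le hr.2
        rw [ht] at this
        exact (div_pos_iff_of_pos_right hpi).1 this
      exact div_le_self this.le hpi1
    rw [ENNReal.ofReal_mul (by positivity), ← ofReal_norm, ← ofReal_norm, Complex.norm_real,
      norm_mul, Real.norm_of_nonneg hpi.le, Real.norm_eq_abs (α n),
      ENNReal.ofReal_pow (by positivity), ENNReal.ofReal_add (by positivity) (by positivity),
      ENNReal.ofReal_one]
    gcongr
  calc ∫⁻ r in Set.Ioc 0 t, ‖((Real.pi * α n : ℝ) : ℂ)‖ₑ * (1 + ‖r‖ₑ) ^ p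
      ≤ ∫⁻ _ in Set.Ioc 0 t, ENNReal.ofReal (Real.pi * |α n| * (1 + max (n - x) 0) ^ p) :=
        setLIntegral_mono measurable_const hb
    _ = ENNReal.ofReal (Real.pi * |α n| * (1 + max (n - x) 0) ^ p) * ENNReal.ofReal t := by
        rw [setLIntegral_const, Real.volume_Ioc, sub_zero]
    _ ≤ ENNReal.ofReal (Real.pi * |α n| * (1 + max (n - x) 0) ^ p) *
          ENNReal.ofReal (max (n - x) 0 / Real.pi) := by
        gcongr
        rw [ht]
        gcongr
        exact le_max_left _ _
    _ = ENNReal.ofReal (coef α p x n) := by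
        rw [← ENNReal.ofReal_mul (by positivity), coef]
        congr 1
        field_simp

/-- Induction on the number of terms, for all `x` at once. After the zeroth term is split off, the
recursion expresses the others through shorter partial sums at the sites `n`, and the supersolution
property closes the estimate. Being uniform in `k`, the bound passes to the whole series. -/
theorem sum_mass_bornTerm_le {α : ℤ → ℝ} {p : ℕ} (h : WeightSummable α p) (k : ℕ) (x : ℝ) :
    ∑ i ∈ Finset.range k, mass p (bornTerm α i x) ≤ ENNReal.ofReal (majorant α p x) := by
  induction k generalizing x with
  | zero => simp
  | succ k ih =>
    refine le_trans ?_ (one_add_tsum_coef_mul_majorant_le h x)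
    rw [Finset.sum_range_succ', add_comm]
    refine add_le_add (mass_dirac p).le ?_
    calc ∑ i ∈ Finset.range k, mass p (bornTerm α (i + 1) x)
        ≤ ∑ i ∈ Finset.range k, ∑' n : ℤ,
            ENNReal.ofReal (coef α p x n) * mass p (bornTerm α i n) := by
          refine Finset.sum_le_sum fun i _ => ?_
          rw [bornTerm, mass_sum]
          exact ENNReal.tsum_le_tsum fun n => mass_smear_le α p x n _
      _ = ∑' n : ℤ, ENNReal.ofReal (coef α p x n) *
            ∑ i ∈ Finset.range k, mass p (bornTerm α i n) := by
          rw [← Summable.tsum_finsetSum fun i _ => ENNReal.summable]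
          simp_rw [Finset.mul_sum]
      _ ≤ _ := ENNReal.tsum_le_tsum fun n => by gcongr; exact ih n

theorem mass_jostMeasure_le {α : ℤ → ℝ} {p : ℕ} (h : WeightSummable α p) (x : ℝ) :
    mass p (jostMeasure α x) ≤ ENNReal.ofReal (majorant α p x) := by
  rw [jostMeasure, mass_sum, ENNReal.tsum_eq_iSup_nat]
  exact iSup_le fun k => sum_mass_bornTerm_le h k x

theorem mass_jostMeasure_ne_top {α : ℤ → ℝ} {p : ℕ} (h : WeightSummable α p) (x : ℝ) :
    mass p (jostMeasure α x) ≠ ⊤ :=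
  ne_top_of_le_ne_top ENNReal.ofReal_ne_top (mass_jostMeasure_le h x)

theorem one_add_mass_scattered (α : ℤ → ℝ) (p : ℕ) (x : ℝ) :
    1 + mass p (scattered α x) = mass p (jostMeasure α x) := by
  rw [jostMeasure, scattered, mass_sum, mass_sum,
    tsum_eq_zero_add' (f := fun i => mass p (bornTerm α i x)) ENNReal.summable]
  exact congrArg (· + _) (mass_dirac p).symm

theorem mass_scattered_ne_top {α : ℤ → ℝ} {p : ℕ} (h : WeightSummable α p) (x : ℝ) :
    mass p (scattered α x) ≠ ⊤ :=
  ne_top_of_le_ne_top (mass_jostMeasure_ne_top h x)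
    (le_add_self.trans (one_add_mass_scattered α p x).le)

theorem toReal_mass_scattered_le {α : ℤ → ℝ} {p : ℕ} (h : WeightSummable α p) (x : ℝ) :
    (mass p (scattered α x)).toReal ≤ majorant α p x - 1 := by
  have h1 := ENNReal.toReal_mono ENNReal.ofReal_ne_top
    ((one_add_mass_scattered α p x).trans_le (mass_jostMeasure_le h x))
  rw [ENNReal.toReal_add ENNReal.one_ne_top (mass_scattered_ne_top h x),
    ENNReal.toReal_ofReal (majorant_pos _ _ _).le, ENNReal.toReal_one] at h1
  linarith

theorem pairing_jostMeasure {α : ℤ → ℝ} {p : ℕ} (h : WeightSummable α p) (x : ℝ) {φ : ℝ → ℂ}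
    (hφ : Measurable φ) {C : ℝ} (hC : ∀ s, ‖φ s‖ ≤ C) :
    pairing (jostMeasure α x) φ = φ 0 + pairing (scattered α x) φ := by
  have h1 := hasSum_pairing (mass_jostMeasure_ne_top h x) hφ hC
  have h2 := hasSum_pairing (mass_scattered_ne_top h x) hφ hC
  rw [jostMeasure, scattered, ← h1.tsum_eq, ← h2.tsum_eq, h1.summable.tsum_eq_zero_add]
  exact congrArg (· + _) (pairing_dirac φ)

/-- The Volterra equation for measures: summing the Born recursion over all orders and exchanging
the two sums. -/
theorem scattered_eq (α : ℤ → ℝ) (x : ℝ) :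
    scattered α x = Measure.sum fun n : ℤ => smear α x n (jostMeasure α n) := by
  unfold scattered jostMeasure smear
  simp_rw [mix_sum _ measurable_const, bornTerm]
  rw [Measure.sum_comm]
  rfl

theorem hasSum_pairing_scattered {α : ℤ → ℝ} {p : ℕ} (h : WeightSummable α p) (x : ℝ) {φ : ℝ → ℂ}
    (hφ : Measurable φ) {C : ℝ} (hC : ∀ s, ‖φ s‖ ≤ C) :
    HasSum (fun n : ℤ => ((Real.pi * α n : ℝ) : ℂ) * ∫ r in Set.Ioc 0 ((n - x) / Real.pi),
      pairing (jostMeasure α n) fun s => φ (r + s)) (pairing (scattered α x) φ) := by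
  have h1 := hasSum_pairing (p := p) (P := fun n : ℤ => smear α x n (jostMeasure α n))
    (by rw [← scattered_eq]; exact mass_scattered_ne_top h x) hφ hC
  rw [← scattered_eq] at h1
  convert h1 using 2 with n
  rw [smear, pairing_mix measurable_const (integrable_const _) (mass_jostMeasure_ne_top h n) hφ hC,
    integral_const_mul]

/-! ### Uniqueness of the Jost solution -/

/-- `f` solves the equation of the delta array, and `f'` is its derivative off the integers. -/
structure IsSolution (α : ℤ → ℝ) (z : ℂ) (f f' : ℝ → ℂ) : Prop where
  continuous : Continuous f
  hasDerivAt : ∀ x : ℝ, x ∉ Set.range ((↑) : ℤ → ℝ) → HasDerivAt f (f' x) x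
  equation : ∀ x : ℝ, x ∉ Set.range ((↑) : ℤ → ℝ) → HasDerivAt f' (-(z ^ 2 * f x)) x
  jump : ∀ n : ℤ, ∃ dl dr : ℂ, Tendsto f' (𝓝[<] (n : ℝ)) (𝓝 dl) ∧
    Tendsto f' (𝓝[>] (n : ℝ)) (𝓝 dr) ∧ dr - dl = α n * f n

theorem IsJostSolution.isSolution {α : ℤ → ℝ} {ε : ℝ} {z : ℂ} {f : ℝ → ℂ}
    (h : IsJostSolution α ε z f) : IsSolution α z f (deriv f) :=
  ⟨h.continuous, fun x hx => (h.differentiableAt x hx).hasDerivAt, h.equation, h.jump⟩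

theorem IsSolution.sub {α : ℤ → ℝ} {z : ℂ} {f f' g g' : ℝ → ℂ} (hf : IsSolution α z f f')
    (hg : IsSolution α z g g') : IsSolution α z (f - g) (f' - g') where
  continuous := hf.continuous.sub hg.continuous
  hasDerivAt x hx := (hf.hasDerivAt x hx).sub (hg.hasDerivAt x hx)
  equation x hx := by
    refine ((hf.equation x hx).sub (hg.equation x hx)).congr_deriv ?_
    simp only [Pi.sub_apply]; ring
  jump n := by
    obtain ⟨a, b, ha, hb, hab⟩ := hf.jump n
    obtain ⟨c, d, hc, hd, hcd⟩ := hg.jump n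
    refine ⟨a - c, b - d, ha.sub hc, hb.sub hd, ?_⟩
    simp only [Pi.sub_apply]
    linear_combination hab - hcd

theorem notMem_range_intCast {n : ℤ} {x : ℝ} (hx : x ∈ Set.Ioo (n : ℝ) (n + 1)) :
    x ∉ Set.range ((↑) : ℤ → ℝ) := by
  rintro ⟨m, rfl⟩
  have h1 : n < m := by exact_mod_cast hx.1
  have h2 : m < n + 1 := by exact_mod_cast hx.2
  omega

theorem mem_Ioo_floor {x : ℝ} (hx : x ∉ Set.range ((↑) : ℤ → ℝ)) :
    x ∈ Set.Ioo (⌊x⌋ : ℝ) (⌊x⌋ + 1) :=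
  ⟨lt_of_le_of_ne (Int.floor_le x) fun h => hx ⟨_, h⟩, Int.lt_floor_add_one x⟩

theorem eq_of_hasDerivAt_zero_Ioo {w : ℝ → ℂ} {a b : ℝ} (h : ∀ x ∈ Set.Ioo a b, HasDerivAt w 0 x)
    {x y : ℝ} (hx : x ∈ Set.Ioo a b) (hy : y ∈ Set.Ioo a b) : w x = w y := by
  have := (convex_Ioo a b).norm_image_sub_le_of_norm_hasDerivWithin_le (f := w) (f' := fun _ => 0)
    (C := 0) (fun x hx => (h x hx).hasDerivWithinAt) (by simp) hy hx
  simpa [sub_eq_zero] using this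

/-- The Wronskian contains derivatives, while the asymptotics control only values. On a unit
interval `f'` varies by at most `‖z‖² B`, and a secant over a distance of at least `1/4` has slope
at most `2B / (1/4) = 8B`. -/
theorem IsSolution.norm_deriv_le {α : ℤ → ℝ} {z : ℂ} {f f' : ℝ → ℂ} (hf : IsSolution α z f f')
    {n : ℤ} {B : ℝ} (hB : ∀ y ∈ Set.Ioo (n : ℝ) (n + 1), ‖f y‖ ≤ B) {x : ℝ}
    (hx : x ∈ Set.Ioo (n : ℝ) (n + 1)) : ‖f' x‖ ≤ (8 + ‖z‖ ^ 2) * B := by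
  have hB0 : 0 ≤ B := (norm_nonneg _).trans (hB x hx)
  obtain ⟨y, hy, hxy⟩ : ∃ y ∈ Set.Ioo (n : ℝ) (n + 1), 1 / 4 ≤ |y - x| := by
    rcases le_or_gt x (n + 1 / 2) with h | h
    · exact ⟨n + 3 / 4, ⟨by linarith, by linarith⟩, le_abs.2 (Or.inl (by linarith))⟩
    · exact ⟨n + 1 / 4, ⟨by linarith, by linarith⟩, le_abs.2 (Or.inr (by linarith))⟩
  have h1 : ∀ s ∈ Set.Ioo (n : ℝ) (n + 1), ‖f' s - f' x‖ ≤ ‖z‖ ^ 2 * B := by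
    intro s hs
    have := (convex_Ioo (n : ℝ) (n + 1)).norm_image_sub_le_of_norm_hasDerivWithin_le
      (f := f') (f' := fun x => -(z ^ 2 * f x)) (C := ‖z‖ ^ 2 * B)
      (fun t ht => (hf.equation t (notMem_range_intCast ht)).hasDerivWithinAt)
      (fun t ht => by
        rw [norm_neg, norm_mul, norm_pow]
        exact mul_le_mul_of_nonneg_left (hB t ht) (by positivity)) hx hs
    refine this.trans (mul_le_of_le_one_right (by positivity) ?_)
    rw [Real.norm_eq_abs, abs_le]
    constructor <;> linarith [hx.1, hx.2, hs.1, hs.2]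
  have h2 := (convex_Ioo (n : ℝ) (n + 1)).norm_image_sub_le_of_norm_hasDerivWithin_le
      (f := fun s : ℝ => f s - (s : ℂ) * f' x) (f' := fun s => f' s - f' x) (C := ‖z‖ ^ 2 * B)
      (fun t ht => by
        have h3 := (hf.hasDerivAt t (notMem_range_intCast ht)).sub
          ((Complex.ofRealCLM.hasDerivAt (x := t)).mul_const (f' x))
        simp only [Complex.ofRealCLM_apply, Complex.ofReal_one, one_mul] at h3
        exact h3.hasDerivWithinAt) h1 hx hy
  have h4 : ‖((y - x : ℝ) : ℂ) * f' x‖ ≤ ‖z‖ ^ 2 * B * ‖y - x‖ + (B + B) := by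
    calc ‖((y - x : ℝ) : ℂ) * f' x‖
        = ‖(f y - f x) - ((f y - (y : ℂ) * f' x) - (f x - (x : ℂ) * f' x))‖ := by
          congr 1; push_cast; ring
      _ ≤ ‖f y - f x‖ + ‖(f y - (y : ℂ) * f' x) - (f x - (x : ℂ) * f' x)‖ := norm_sub_le _ _
      _ ≤ (B + B) + ‖z‖ ^ 2 * B * ‖y - x‖ :=
          add_le_add ((norm_sub_le _ _).trans (add_le_add (hB y hy) (hB x hx))) h2
      _ = _ := by ring
  rw [norm_mul, Complex.norm_real, Real.norm_eq_abs] at h4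
  have h5 : |y - x| * (‖f' x‖ - ‖z‖ ^ 2 * B) ≤ 2 * B := by linarith
  by_contra! h6
  have : 1 / 4 * (8 * B) < |y - x| * (‖f' x‖ - ‖z‖ ^ 2 * B) := by
    have h7 : 8 * B < ‖f' x‖ - ‖z‖ ^ 2 * B := by linarith
    nlinarith
  linarith

/-- The equation makes the Wronskian constant between integers; at an integer `n` the two jump
contributions are both `αₙ f g` and cancel. -/
theorem IsSolution.wronskian_const {α : ℤ → ℝ} {z : ℂ} {f f' g g' : ℝ → ℂ}
    (hf : IsSolution α z f f') (hg : IsSolution α z g g') :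
    ∃ c : ℂ, ∀ x : ℝ, x ∉ Set.range ((↑) : ℤ → ℝ) → f x * g' x - f' x * g x = c := by
  have hconst : ∀ n : ℤ, ∀ x ∈ Set.Ioo (n : ℝ) (n + 1), ∀ y ∈ Set.Ioo (n : ℝ) (n + 1),
      f x * g' x - f' x * g x = f y * g' y - f' y * g y := by
    intro n x hx y hy
    refine eq_of_hasDerivAt_zero_Ioo (w := fun x => f x * g' x - f' x * g x) (fun t ht => ?_) hx hy
    have ht' := notMem_range_intCast ht
    refine (((hf.hasDerivAt t ht').mul (hg.equation t ht')).sub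
      ((hf.equation t ht').mul (hg.hasDerivAt t ht'))).congr_deriv ?_
    ring
  have hmid : ∀ n : ℤ, (n : ℝ) + 1 / 2 ∈ Set.Ioo (n : ℝ) (n + 1) := fun n =>
    ⟨by linarith, by linarith⟩
  set c : ℤ → ℂ := fun n => f ((n : ℝ) + 1 / 2) * g' ((n : ℝ) + 1 / 2) -
    f' ((n : ℝ) + 1 / 2) * g ((n : ℝ) + 1 / 2) with hc
  have hstep : ∀ n : ℤ, c (n - 1) = c n := by
    intro n
    obtain ⟨a, b, ha, hb, hab⟩ := hf.jump n
    obtain ⟨a', b', ha', hb', hab'⟩ := hg.jump n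
    have hfl := (hf.continuous.tendsto (n : ℝ)).mono_left (nhdsWithin_le_nhds (s := Set.Iio (n : ℝ)))
    have hfr := (hf.continuous.tendsto (n : ℝ)).mono_left (nhdsWithin_le_nhds (s := Set.Ioi (n : ℝ)))
    have hgl := (hg.continuous.tendsto (n : ℝ)).mono_left (nhdsWithin_le_nhds (s := Set.Iio (n : ℝ)))
    have hgr := (hg.continuous.tendsto (n : ℝ)).mono_left (nhdsWithin_le_nhds (s := Set.Ioi (n : ℝ)))
    have hl : f n * a' - a * g n = c (n - 1) := by
      refine tendsto_nhds_unique ((hfl.mul ha').sub (ha.mul hgl)) ?_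
      refine tendsto_const_nhds.congr' ?_
      filter_upwards [Ioo_mem_nhdsLT (show (n : ℝ) - 1 < n by linarith)] with x hx
      exact (hconst (n - 1) x (by push_cast; simpa using hx) _ (hmid (n - 1))).symm
    have hr : f n * b' - b * g n = c n := by
      refine tendsto_nhds_unique ((hfr.mul hb').sub (hb.mul hgr)) ?_
      refine tendsto_const_nhds.congr' ?_
      filter_upwards [Ioo_mem_nhdsGT (show (n : ℝ) < n + 1 by linarith)] with x hx
      exact (hconst n x hx _ (hmid n)).symm
    rw [← hl, ← hr]
    linear_combination g n * hab - f n * hab'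
  have hall : ∀ n : ℤ, c n = c 0 := by
    intro n
    induction n with
    | zero => rfl
    | succ i ih => rw [← ih, ← hstep]; simp
    | pred i ih => rw [← ih, hstep]
  refine ⟨c 0, fun x hx => ?_⟩
  rw [← hall ⌊x⌋]
  exact hconst ⌊x⌋ x (mem_Ioo_floor hx) _ (hmid _)

/-- Vanishing on the right gives zero Cauchy data at `N` from the left, by the jump condition. The
operator factors as `(∂ + iz)(∂ - iz)`, so `(f' - izf) e^{izx}` and then `f e^{-izx}` are constant
with limit `0` at `N`. No case distinction at `z = 0` is needed. -/
theorem IsSolution.eq_zero_of_Ici {α : ℤ → ℝ} {z : ℂ} {f f' : ℝ → ℂ} (hf : IsSolution α z f f')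
    {N : ℤ} (h : ∀ x : ℝ, N ≤ x → f x = 0) : ∀ x : ℝ, N - 1 ≤ x → f x = 0 := by
  obtain ⟨dl, dr, hl, hr, hd⟩ := hf.jump N
  have hr0 : dr = 0 := by
    refine tendsto_nhds_unique hr (tendsto_const_nhds.congr' ?_)
    filter_upwards [Ioo_mem_nhdsGT (show (N : ℝ) < N + 1 by linarith)] with x hx
    have h1 := hf.hasDerivAt x (notMem_range_intCast hx)
    have h2 : HasDerivAt f 0 x := by
      refine (hasDerivAt_const x (0 : ℂ)).congr_of_eventuallyEq ?_
      filter_upwards [Ioi_mem_nhds hx.1] with y hy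
      exact h y (le_of_lt hy)
    exact h2.unique h1
  have hl0 : dl = 0 := by
    rw [hr0, h N le_rfl] at hd
    simpa using hd
  have hexp : ∀ (c : ℂ) (x : ℝ), HasDerivAt (fun y : ℝ => Complex.exp (c * y))
      (Complex.exp (c * x) * c) x := by
    intro c x
    have := ((Complex.ofRealCLM.hasDerivAt (x := x)).const_mul c).cexp
    simpa using this
  have hmem : ∀ x ∈ Set.Ioo ((N : ℝ) - 1) N, x ∉ Set.range ((↑) : ℤ → ℝ) := fun x hx =>
    notMem_range_intCast (n := N - 1) (by push_cast; simpa using hx)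
  have hcont := (hf.continuous.tendsto (N : ℝ)).mono_left
    (nhdsWithin_le_nhds (s := Set.Iio (N : ℝ)))
  rw [h N le_rfl] at hcont
  have hexpl : ∀ c : ℂ, Tendsto (fun y : ℝ => Complex.exp (c * y)) (𝓝[<] (N : ℝ))
      (𝓝 (Complex.exp (c * (N : ℝ)))) := fun c =>
    (hexp c N).continuousAt.tendsto.mono_left nhdsWithin_le_nhds
  have key : ∀ w : ℝ → ℂ, (∀ x ∈ Set.Ioo ((N : ℝ) - 1) N, HasDerivAt w 0 x) →
      Tendsto w (𝓝[<] (N : ℝ)) (𝓝 0) → ∀ x ∈ Set.Ioo ((N : ℝ) - 1) N, w x = 0 := by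
    intro w hw hlim x hx
    refine tendsto_nhds_unique (tendsto_const_nhds.congr' ?_) hlim
    filter_upwards [Ioo_mem_nhdsLT (show (N : ℝ) - 1 < N by linarith)] with y hy
    exact eq_of_hasDerivAt_zero_Ioo hw hx hy
  have h1 : ∀ x ∈ Set.Ioo ((N : ℝ) - 1) N, f' x = Complex.I * z * f x := by
    intro x hx
    have := key (fun x => (f' x - Complex.I * z * f x) * Complex.exp ((Complex.I * z) * x))
      (fun x hx => by
        refine (((hf.equation x (hmem x hx)).sub
          ((hf.hasDerivAt x (hmem x hx)).const_mul (Complex.I * z))).mul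
            (hexp (Complex.I * z) x)).congr_deriv ?_
        simp only [Pi.sub_apply]
        linear_combination (-z ^ 2 * f x * Complex.exp (Complex.I * z * x)) * Complex.I_sq)
      (by
        have := (hl.sub (hcont.const_mul (Complex.I * z))).mul (hexpl (Complex.I * z))
        simpa [hl0] using this) x hx
    rcases mul_eq_zero.1 this with h0 | h0
    · exact sub_eq_zero.1 h0
    · exact absurd h0 (Complex.exp_ne_zero _)
  have h2 : ∀ x ∈ Set.Ioo ((N : ℝ) - 1) N, f x = 0 := by
    intro x hx
    have := key (fun x => f x * Complex.exp (-(Complex.I * z) * x))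
      (fun x hx => by
        refine ((hf.hasDerivAt x (hmem x hx)).mul (hexp (-(Complex.I * z)) x)).congr_deriv ?_
        rw [h1 x hx]
        ring)
      (by simpa using hcont.mul (hexpl (-(Complex.I * z)))) x hx
    rcases mul_eq_zero.1 this with h0 | h0
    · exact h0
    · exact absurd h0 (Complex.exp_ne_zero _)
  intro x hx
  rcases lt_or_ge x N with hxN | hxN
  · rcases hx.eq_or_lt with rfl | hx'
    · refine tendsto_nhds_unique ((hf.continuous.tendsto ((N : ℝ) - 1)).mono_left
        (nhdsWithin_le_nhds (s := Set.Ioi ((N : ℝ) - 1)))) (tendsto_const_nhds.congr' ?_)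
      filter_upwards [Ioo_mem_nhdsGT hxN] with y hy
      exact (h2 y hy).symm
    · exact h2 x ⟨hx', hxN⟩
  · exact h x hxN

theorem comap_one_mul_atTop : comap (fun x : ℝ => (1 : ℝ) * x) atTop = atTop := by
  simp [comap_id']

theorem norm_plane_wave (l x : ℝ) : ‖Complex.exp (Complex.I * (1 : ℝ) * l * x)‖ = 1 := by
  have : Complex.I * (1 : ℝ) * l * x = ((l * x : ℝ) : ℂ) * Complex.I := by push_cast; ring
  rw [this, Complex.norm_exp_ofReal_mul_I]

theorem IsJostSolution.tendsto_sub {α : ℤ → ℝ} {l : ℝ} {f : ℝ → ℂ}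
    (h : IsJostSolution α 1 l f) :
    Tendsto (fun x : ℝ => f x - Complex.exp (Complex.I * (1 : ℝ) * l * x)) atTop (𝓝 0) := by
  have h1 := h.asymptotic.isLittleO
  rw [comap_one_mul_atTop] at h1
  have h2 := h1.norm_right
  simp_rw [norm_plane_wave] at h2
  exact (Asymptotics.isLittleO_one_iff ℝ).1 h2

/-- The Wronskian of `f` and `f - g` is constant and tends to `0`, hence is zero. For real `l` the
plane wave has modulus one, so `f` does not vanish near `+∞`; there `(f - g)/f` is constant with
limit `0`. The zero then propagates to the left one unit interval at a time. -/
theorem IsJostSolution.unique {α : ℤ → ℝ} {l : ℝ} {f g : ℝ → ℂ}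
    (hf : IsJostSolution α 1 l f) (hg : IsJostSolution α 1 l g) : f = g := by
  have hd := hf.isSolution.sub hg.isSolution
  have hd0 : Tendsto (f - g) atTop (𝓝 0) := by
    have := hf.tendsto_sub.sub hg.tendsto_sub
    simp only [sub_sub_sub_cancel_right, sub_zero] at this
    exact this
  obtain ⟨X, hX⟩ := eventually_atTop.1 ((Metric.tendsto_nhds.1 hf.tendsto_sub) (1 / 2) (by norm_num))
  have hlow : ∀ x, X ≤ x → 1 / 2 ≤ ‖f x‖ ∧ ‖f x‖ ≤ 2 := by
    intro x hx
    have h1 := hX x hx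
    rw [dist_zero_right] at h1
    have h2 := norm_plane_wave l x
    have h3 := norm_sub_norm_le (Complex.exp (Complex.I * (1 : ℝ) * l * x)) (f x)
    have h4 := norm_sub_norm_le (f x) (Complex.exp (Complex.I * (1 : ℝ) * l * x))
    rw [norm_sub_rev] at h3
    constructor <;> linarith
  obtain ⟨c, hc⟩ := hf.isSolution.wronskian_const hd
  have hc0 : c = 0 := by
    rw [← norm_le_zero_iff]
    refine le_of_forall_pos_le_add fun δ hδ => ?_
    set K : ℝ := 8 + ‖(l : ℂ)‖ ^ 2 with hK
    have hKpos : 0 < K := by positivity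
    -- With `‖f‖ ≤ 2` and derivatives controlled by the factor `K`, each product in the Wronskian is
    -- at most `δ/2`.
    obtain ⟨Y, hY⟩ := eventually_atTop.1 ((Metric.tendsto_nhds.1 hd0) (δ / (4 * K)) (by positivity))
    obtain ⟨n, hn⟩ := exists_int_gt (max X Y)
    have hXn : X ≤ n := (le_max_left _ _).trans hn.le
    have hYn : Y ≤ n := (le_max_right _ _).trans hn.le
    have hm : (n : ℝ) + 1 / 2 ∈ Set.Ioo (n : ℝ) (n + 1) := ⟨by linarith, by linarith⟩
    have hfB : ∀ y ∈ Set.Ioo (n : ℝ) (n + 1), ‖f y‖ ≤ 2 := fun y hy =>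
      (hlow y (hXn.trans hy.1.le)).2
    have hdB : ∀ y ∈ Set.Ioo (n : ℝ) (n + 1), ‖(f - g) y‖ ≤ δ / (4 * K) := fun y hy => by
      have := hY y (hYn.trans hy.1.le)
      rw [dist_zero_right] at this
      exact this.le
    have h1 := hf.isSolution.norm_deriv_le hfB hm
    have h2 := hd.norm_deriv_le hdB hm
    rw [← hc _ (notMem_range_intCast hm)]
    calc _ ≤ ‖f ((n : ℝ) + 1 / 2)‖ * ‖(deriv f - deriv g) ((n : ℝ) + 1 / 2)‖ +
          ‖deriv f ((n : ℝ) + 1 / 2)‖ * ‖(f - g) ((n : ℝ) + 1 / 2)‖ := by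
          rw [← norm_mul, ← norm_mul]
          exact norm_sub_le _ _
      _ ≤ 2 * (K * (δ / (4 * K))) + (K * 2) * (δ / (4 * K)) := by
          gcongr
          · exact hfB _ hm
          · exact hdB _ hm
      _ = 0 + δ := by field_simp; ring
  have hratio : ∀ x y, X ≤ x → x ≤ y → (f - g) y / f y = (f - g) x / f x := by
    intro x y hx hxy
    have hne : ∀ t, X ≤ t → f t ≠ 0 := fun t ht h0 => by
      have := (hlow t ht).1
      rw [h0, norm_zero] at this
      linarith
    -- The quotient is continuous, so the integers may be ignored as a countable exceptional set.
    have := integral_eq_of_hasDerivAt_off_countable_of_le (fun t => (f - g) t / f t)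
      (fun _ => 0) hxy (Set.countable_range ((↑) : ℤ → ℝ))
      (hd.continuous.continuousOn.div hf.continuous.continuousOn fun t ht => hne t (hx.trans ht.1))
      (fun t ht => by
        have h1 := (hd.hasDerivAt t ht.2).div (hf.isSolution.hasDerivAt t ht.2)
          (hne t (hx.trans ht.1.1.le))
        refine h1.congr_deriv ?_
        have h2 := hc t ht.2
        rw [hc0] at h2
        rw [div_eq_zero_iff]
        left
        linear_combination h2)
      (by simp)
    rw [intervalIntegral.integral_zero] at this
    exact sub_eq_zero.1 this.symm
  have hzero : ∀ x, X ≤ x → (f - g) x = 0 := by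
    intro x hx
    have hlim : Tendsto (fun y => (f - g) y / f y) atTop (𝓝 0) := by
      refine squeeze_zero_norm' (a := fun y => 2 * ‖(f - g) y‖) ?_ (by simpa using hd0.norm.const_mul 2)
      filter_upwards [eventually_ge_atTop X] with y hy
      rw [norm_div, div_le_iff₀ (by linarith [(hlow y hy).1])]
      nlinarith [(hlow y hy).1, norm_nonneg ((f - g) y)]
    have : (f - g) x / f x = 0 := by
      refine tendsto_nhds_unique (tendsto_const_nhds.congr' ?_) hlim
      filter_upwards [eventually_ge_atTop x] with y hy
      exact (hratio x y hx hy).symm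
    rcases div_eq_zero_iff.1 this with h0 | h0
    · exact h0
    · have := (hlow x hx).1
      rw [h0, norm_zero] at this
      linarith
  obtain ⟨N, hN⟩ := exists_int_gt X
  have hback : ∀ k : ℕ, ∀ x : ℝ, (N : ℝ) - k ≤ x → (f - g) x = 0 := by
    intro k
    induction k with
    | zero => intro x hx; exact hzero x (by simp at hx; linarith)
    | succ k ih =>
      intro x hx
      refine hd.eq_zero_of_Ici (N := N - k) (fun y hy => ih y (by push_cast at hy; exact hy)) x ?_
      push_cast at hx ⊢
      linarith
  ext x
  obtain ⟨k, hk⟩ := exists_nat_ge ((N : ℝ) - x)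
  exact sub_eq_zero.1 (hback k x (by linarith))

/-! ### Existence: the Jost solution as a Fourier integral of `jostMeasure` -/

/-- The sequence `α` cut off to the left of `N`. -/
noncomputable def tail (α : ℤ → ℝ) (N : ℤ) : ℤ → ℝ := (Set.Ici N).indicator α

theorem tail_of_le {α : ℤ → ℝ} {N n : ℤ} (h : N ≤ n) : tail α N n = α n :=
  Set.indicator_of_mem (Set.mem_Ici.2 h) _

theorem tail_of_lt {α : ℤ → ℝ} {N n : ℤ} (h : n < N) : tail α N n = 0 :=
  Set.indicator_of_notMem (by simpa using h) _

/-- On `[N - 1, N]` exactly the sites `n ≥ N` can contribute, since for `n ≤ N - 1` the interval is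
empty. The cut-off no longer depends on `x`, and oriented interval integrals make each term
differentiable in `x`, endpoints included. -/
theorem hasSum_pairing_scattered_tail {α : ℤ → ℝ} {p : ℕ} (h : WeightSummable α p) {N : ℤ} {x : ℝ}
    (hx : x ∈ Set.Icc ((N : ℝ) - 1) N) {φ : ℝ → ℂ} (hφ : Measurable φ) {C : ℝ}
    (hC : ∀ s, ‖φ s‖ ≤ C) :
    HasSum (fun n : ℤ => ((Real.pi * tail α N n : ℝ) : ℂ) * ∫ r in (0 : ℝ)..((n - x) / Real.pi),
      pairing (jostMeasure α n) fun s => φ (r + s)) (pairing (scattered α x) φ) := by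
  convert hasSum_pairing_scattered h x hφ hC using 2 with n
  have hpi := Real.pi_pos
  rcases le_or_gt N n with hn | hn
  · have hn' : (N : ℝ) ≤ n := by exact_mod_cast hn
    rw [tail_of_le hn, intervalIntegral.integral_of_le
      (div_nonneg (by linarith [hx.2]) hpi.le)]
  · have hn' : (n : ℝ) ≤ N - 1 := by exact_mod_cast Int.le_sub_one_of_lt hn
    rw [tail_of_lt hn, Set.Ioc_eq_empty]
    · simp
    · rw [not_lt]
      exact div_nonpos_of_nonpos_of_nonneg (by linarith [hx.1]) hpi.le

theorem norm_pairing_jostMeasure_le {α : ℤ → ℝ} {p : ℕ} (h : WeightSummable α p) (x : ℝ)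
    {φ : ℝ → ℂ} {C : ℝ} (hC : ∀ s, ‖φ s‖ ≤ C) :
    ‖pairing (jostMeasure α x) φ‖ ≤ C * majorant α p x := by
  refine (norm_pairing_le (mass_jostMeasure_ne_top h x) hC).trans ?_
  refine mul_le_mul_of_nonneg_left ?_ ((norm_nonneg _).trans (hC 0))
  exact ENNReal.toReal_le_of_le_ofReal (majorant_pos _ _ _).le (mass_jostMeasure_le h x)

theorem summable_tail_mul {α : ℤ → ℝ} {p : ℕ} (h : WeightSummable α p) (N : ℤ) {C : ℝ} {b : ℤ → ℂ}
    (hb : ∀ n, N ≤ n → ‖b n‖ ≤ C * (1 + |(n : ℝ)|) ^ (p + 1)) :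
    Summable fun n : ℤ => (tail α N n : ℂ) * b n := by
  refine Summable.of_norm_bounded (h.mul_left C) fun n => ?_
  rcases le_or_gt N n with hn | hn
  · rw [tail_of_le hn, norm_mul, Complex.norm_real, Real.norm_eq_abs]
    calc |α n| * ‖b n‖ ≤ |α n| * (C * (1 + |(n : ℝ)|) ^ (p + 1)) := by gcongr; exact hb n hn
      _ = _ := by ring
  · have : 0 ≤ C := by
      have h1 := (norm_nonneg _).trans (hb N le_rfl)
      exact nonneg_of_mul_nonneg_left h1 (by positivity)
    simp only [tail_of_lt hn, Complex.ofReal_zero, zero_mul, norm_zero]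
    positivity

/-- The character `ξ ↦ exp (2 π i l ξ)`. -/
noncomputable def character (l ξ : ℝ) : ℂ := Complex.exp (2 * Real.pi * Complex.I * l * ξ)

theorem continuous_character (l : ℝ) : Continuous (character l) := by
  unfold character; fun_prop

theorem norm_character (l ξ : ℝ) : ‖character l ξ‖ = 1 := by
  have : 2 * Real.pi * Complex.I * l * ξ = ((2 * Real.pi * l * ξ : ℝ) : ℂ) * Complex.I := by
    push_cast; ring
  rw [character, this, Complex.norm_exp_ofReal_mul_I]

theorem character_add (l ξ η : ℝ) : character l (ξ + η) = character l ξ * character l η := by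
  unfold character
  rw [← Complex.exp_add]
  congr 1; push_cast; ring

theorem hasDerivAt_exp_const_mul (c : ℂ) (x : ℝ) :
    HasDerivAt (fun y : ℝ => Complex.exp (c * y)) (Complex.exp (c * x) * c) x := by
  simpa using ((Complex.ofRealCLM.hasDerivAt (x := x)).const_mul c).cexp

/-- The primitive `∫₀ʸ exp (2 i l u) du`. -/
noncomputable def expPrimitive (l y : ℝ) : ℂ :=
  ∫ u in (0 : ℝ)..y, Complex.exp (2 * Complex.I * l * u)

theorem hasDerivAt_expPrimitive (l y : ℝ) :
    HasDerivAt (expPrimitive l) (Complex.exp (2 * Complex.I * l * y)) y := by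
  have hc : Continuous fun u : ℝ => Complex.exp (2 * Complex.I * l * u) := by fun_prop
  exact intervalIntegral.integral_hasDerivAt_right (hc.intervalIntegrable _ _)
    hc.stronglyMeasurable.stronglyMeasurableAtFilter hc.continuousAt

theorem norm_expPrimitive_le (l y : ℝ) : ‖expPrimitive l y‖ ≤ |y| := by
  have := intervalIntegral.norm_integral_le_of_norm_le_const (a := 0) (b := y) (C := 1)
    (f := fun u : ℝ => Complex.exp (2 * Complex.I * l * u)) (fun u _ => by
      have : 2 * Complex.I * l * u = ((2 * l * u : ℝ) : ℂ) * Complex.I := by push_cast; ring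
      rw [this, Complex.norm_exp_ofReal_mul_I])
  simpa [expPrimitive] using this

/-- The substitution `u = x + πr` separates `x` from the site `y`, so that the sums over sites
become coefficients independent of `x`. A primitive in place of a division by `2il` keeps `l = 0`
included. -/
theorem pi_mul_integral_character (l x y : ℝ) :
    Real.pi * ∫ r in (0 : ℝ)..((y - x) / Real.pi), character l r =
      Complex.exp (-(2 * Complex.I * l * x)) * (expPrimitive l y - expPrimitive l x) := by
  have hpi := Real.pi_pos
  have hpi' : (Real.pi : ℂ) ≠ 0 := by exact_mod_cast hpi.ne'
  have h1 := intervalIntegral.integral_comp_div (f := character l) (a := 0) (b := y - x) hpi.ne'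
  rw [zero_div, Complex.real_smul] at h1
  rw [← h1]
  have h2 := intervalIntegral.integral_comp_sub_right (a := x) (b := y)
    (fun u => character l (u / Real.pi)) x
  rw [sub_self] at h2
  rw [← h2]
  have hc : Continuous fun u : ℝ => Complex.exp (2 * Complex.I * l * u) := by fun_prop
  rw [expPrimitive, expPrimitive, intervalIntegral.integral_interval_sub_left
    (hc.intervalIntegrable _ _) (hc.intervalIntegrable _ _), ← intervalIntegral.integral_const_mul]
  refine intervalIntegral.integral_congr fun u _ => ?_
  rw [character, ← Complex.exp_add]
  congr 1
  push_cast
  field_simp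
  ring

/-- The normalized Jost solution as the Fourier transform of `jostMeasure`. -/
noncomputable def mFun (α : ℤ → ℝ) (l x : ℝ) : ℂ := pairing (jostMeasure α x) (character l)

theorem mFun_eq {α : ℤ → ℝ} {p : ℕ} (h : WeightSummable α p) (l x : ℝ) :
    mFun α l x = 1 + pairing (scattered α x) (character l) := by
  rw [mFun, pairing_jostMeasure h x (continuous_character l).measurable
    (fun s => (norm_character l s).le)]
  simp [character]

theorem norm_mFun_le {α : ℤ → ℝ} {p : ℕ} (h : WeightSummable α p) (l x : ℝ) :
    ‖mFun α l x‖ ≤ majorant α p x := by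
  simpa [mFun] using norm_pairing_jostMeasure_le h x (fun s => (norm_character l s).le)

theorem norm_mFun_sub_one_le {α : ℤ → ℝ} {p : ℕ} (h : WeightSummable α p) (l x : ℝ) :
    ‖mFun α l x - 1‖ ≤ majorant α p x - 1 := by
  rw [mFun_eq h, add_sub_cancel_left]
  refine (norm_pairing_le (mass_scattered_ne_top h x) (fun s => (norm_character l s).le)).trans ?_
  rw [one_mul]
  exact toReal_mass_scattered_le h x

/-- The coefficient `∑_{n ≥ N} αₙ mₙ E(n)`. -/
noncomputable def coeffA (α : ℤ → ℝ) (l : ℝ) (N : ℤ) : ℂ :=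
  ∑' n : ℤ, (tail α N n : ℂ) * (mFun α l n * expPrimitive l n)

/-- The coefficient `∑_{n ≥ N} αₙ mₙ`. -/
noncomputable def coeffB (α : ℤ → ℝ) (l : ℝ) (N : ℤ) : ℂ :=
  ∑' n : ℤ, (tail α N n : ℂ) * mFun α l n

theorem summable_coeffA {α : ℤ → ℝ} {p : ℕ} (h : WeightSummable α p) (l : ℝ) (N : ℤ) :
    Summable fun n : ℤ => (tail α N n : ℂ) * (mFun α l n * expPrimitive l n) := by
  refine summable_tail_mul h N (C := majorant α p N) fun n hn => ?_
  rw [norm_mul]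
  have h1 : ‖mFun α l n‖ ≤ majorant α p N :=
    (norm_mFun_le h l n).trans (majorant_anti h (by exact_mod_cast hn))
  have h2 : ‖expPrimitive l n‖ ≤ (1 + |(n : ℝ)|) ^ (p + 1) :=
    (norm_expPrimitive_le l n).trans ((by linarith : |(n : ℝ)| ≤ 1 + |(n : ℝ)|).trans
      (le_self_pow₀ (by linarith [abs_nonneg (n : ℝ)]) (by simp)))
  have := (majorant_pos α p N).le
  gcongr

theorem summable_coeffB {α : ℤ → ℝ} {p : ℕ} (h : WeightSummable α p) (l : ℝ) (N : ℤ) :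
    Summable fun n : ℤ => (tail α N n : ℂ) * mFun α l n := by
  refine summable_tail_mul h N (C := majorant α p N) fun n hn => ?_
  have h1 : ‖mFun α l n‖ ≤ majorant α p N :=
    (norm_mFun_le h l n).trans (majorant_anti h (by exact_mod_cast hn))
  exact h1.trans (le_mul_of_one_le_right (majorant_pos α p N).le
    (one_le_pow₀ (by linarith [abs_nonneg (n : ℝ)])))

theorem tail_sub_tail_succ (α : ℤ → ℝ) (N n : ℤ) :
    tail α N n - tail α (N + 1) n = if n = N then α N else 0 := by
  rcases lt_trichotomy n N with h | rfl | h
  · rw [tail_of_lt h, tail_of_lt (by omega), if_neg h.ne, sub_zero]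
  · rw [tail_of_le le_rfl, tail_of_lt (by omega), if_pos rfl, sub_zero]
  · rw [tail_of_le h.le, tail_of_le (by omega), if_neg h.ne', sub_self]

theorem tsum_tail_sub {α : ℤ → ℝ} {N : ℤ} {b : ℤ → ℂ}
    (h1 : Summable fun n : ℤ => (tail α N n : ℂ) * b n)
    (h2 : Summable fun n : ℤ => (tail α (N + 1) n : ℂ) * b n) :
    ∑' n : ℤ, (tail α N n : ℂ) * b n - ∑' n : ℤ, (tail α (N + 1) n : ℂ) * b n = α N * b N := by
  rw [← h1.tsum_sub h2]
  simp_rw [← sub_mul, ← Complex.ofReal_sub, tail_sub_tail_succ]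
  rw [tsum_eq_single N]
  · simp
  · intro n hn
    simp [hn]

/-- The Jost solution on the interval `[N - 1, N]`. -/
noncomputable def jostPiece (α : ℤ → ℝ) (l : ℝ) (N : ℤ) (x : ℝ) : ℂ :=
  Complex.exp (Complex.I * l * x) + Complex.exp (-(Complex.I * l) * x) *
    (coeffA α l N - coeffB α l N * expPrimitive l x)

/-- The derivative of the Jost solution on the interval `[N - 1, N]`. -/
noncomputable def jostPieceDeriv (α : ℤ → ℝ) (l : ℝ) (N : ℤ) (x : ℝ) : ℂ :=
  Complex.I * l * Complex.exp (Complex.I * l * x) -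
    Complex.I * l * Complex.exp (-(Complex.I * l) * x) *
      (coeffA α l N - coeffB α l N * expPrimitive l x) -
    Complex.exp (Complex.I * l * x) * coeffB α l N

theorem exp_neg_mul_exp_two (l x : ℝ) :
    Complex.exp (-(Complex.I * l) * x) * Complex.exp (2 * Complex.I * l * x) =
      Complex.exp (Complex.I * l * x) := by
  rw [← Complex.exp_add]; congr 1; ring

theorem hasDerivAt_jostPiece (α : ℤ → ℝ) (l : ℝ) (N : ℤ) (x : ℝ) :
    HasDerivAt (jostPiece α l N) (jostPieceDeriv α l N x) x := by
  refine ((hasDerivAt_exp_const_mul (Complex.I * l) x).add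
    ((hasDerivAt_exp_const_mul (-(Complex.I * l)) x).mul
      (((hasDerivAt_expPrimitive l x).const_mul (coeffB α l N)).const_sub
        (coeffA α l N)))).congr_deriv ?_
  rw [jostPieceDeriv, ← exp_neg_mul_exp_two]
  ring

theorem hasDerivAt_jostPieceDeriv (α : ℤ → ℝ) (l : ℝ) (N : ℤ) (x : ℝ) :
    HasDerivAt (jostPieceDeriv α l N) (-((l : ℂ) ^ 2 * jostPiece α l N x)) x := by
  refine ((((hasDerivAt_exp_const_mul (Complex.I * l) x).const_mul (Complex.I * l)).sub
    (((hasDerivAt_exp_const_mul (-(Complex.I * l)) x).const_mul (Complex.I * l)).mul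
      (((hasDerivAt_expPrimitive l x).const_mul (coeffB α l N)).const_sub
        (coeffA α l N)))).sub
    ((hasDerivAt_exp_const_mul (Complex.I * l) x).mul_const (coeffB α l N))).congr_deriv ?_
  rw [jostPiece]
  linear_combination (Complex.I * l * coeffB α l N) * exp_neg_mul_exp_two l x +
    ((l : ℂ) ^ 2 * Complex.exp (Complex.I * l * x) + (l : ℂ) ^ 2 *
      Complex.exp (-(Complex.I * l) * x) * (coeffA α l N - coeffB α l N * expPrimitive l x)) *
      Complex.I_sq

/-- The cut-offs at `N` and `N + 1` differ by the single site `N`. Its terms containing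
`expPrimitive l N` cancel, leaving the prescribed jump. -/
theorem jostPieceDeriv_sub {α : ℤ → ℝ} {p : ℕ} (h : WeightSummable α p) (l : ℝ) (N : ℤ) :
    jostPieceDeriv α l (N + 1) N - jostPieceDeriv α l N N =
      α N * (Complex.exp (Complex.I * l * N) * mFun α l N) := by
  have hA := tsum_tail_sub (summable_coeffA h l N) (summable_coeffA h l (N + 1))
  have hB := tsum_tail_sub (summable_coeffB h l N) (summable_coeffB h l (N + 1))
  change coeffA α l N - coeffA α l (N + 1) = _ at hA
  change coeffB α l N - coeffB α l (N + 1) = _ at hB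
  unfold jostPieceDeriv
  push_cast
  linear_combination (Complex.I * l * Complex.exp (-(Complex.I * l) * N)) * hA +
    (Complex.exp (Complex.I * l * N) -
      Complex.I * l * Complex.exp (-(Complex.I * l) * N) * expPrimitive l N) * hB

/-- Characters turn convolution into multiplication, so the equation between measures becomes the
scalar Volterra equation. -/
theorem exp_mul_mFun_eq_jostPiece {α : ℤ → ℝ} {p : ℕ} (h : WeightSummable α p) (l : ℝ) {N : ℤ}
    {x : ℝ} (hx : x ∈ Set.Icc ((N : ℝ) - 1) N) :
    Complex.exp (Complex.I * l * x) * mFun α l x = jostPiece α l N x := by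
  have h1 := hasSum_pairing_scattered_tail h hx (continuous_character l).measurable
    (fun s => (norm_character l s).le)
  have hterm : ∀ n : ℤ, ((Real.pi * tail α N n : ℝ) : ℂ) *
      ∫ r in (0 : ℝ)..((n - x) / Real.pi),
        pairing (jostMeasure α n) (fun s => character l (r + s)) =
      Complex.exp (-(2 * Complex.I * l * x)) *
        ((tail α N n : ℂ) * (mFun α l n * expPrimitive l n) -
          (tail α N n : ℂ) * mFun α l n * expPrimitive l x) := by
    intro n
    have : ∀ r, pairing (jostMeasure α n) (fun s => character l (r + s)) =
        character l r * mFun α l n := by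
      intro r
      unfold mFun pairing
      rw [← integral_const_mul]
      refine integral_congr_ae (Eventually.of_forall fun q => ?_)
      simp only [character_add]; ring
    simp_rw [this]
    rw [intervalIntegral.integral_mul_const]
    have h2 := pi_mul_integral_character l x n
    push_cast
    linear_combination (tail α N n : ℂ) * mFun α l n * h2
  simp_rw [hterm] at h1
  have h2 := (((summable_coeffA h l N).hasSum.sub
    ((summable_coeffB h l N).hasSum.mul_right (expPrimitive l x))).mul_left
      (Complex.exp (-(2 * Complex.I * l * x)))).unique h1
  rw [mFun_eq h, ← h2, jostPiece, coeffA, coeffB]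
  have : Complex.exp (Complex.I * l * x) * Complex.exp (-(2 * Complex.I * l * x)) =
      Complex.exp (-(Complex.I * l) * x) := by
    rw [← Complex.exp_add]; congr 1; ring
  rw [← this]
  ring

theorem eventuallyEq_nhdsLE {E : Type*} {f g : ℝ → E} {N : ℤ} {x : ℝ}
    (h : ∀ y ∈ Set.Icc ((N : ℝ) - 1) N, f y = g y) (hx : (N : ℝ) - 1 < x) (hx' : x ≤ N) :
    f =ᶠ[𝓝[≤] x] g := by
  filter_upwards [Icc_mem_nhdsLE hx] with y hy
  exact h y ⟨hy.1, hy.2.trans hx'⟩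

theorem eventuallyEq_nhdsGE {E : Type*} {f g : ℝ → E} {N : ℤ} {x : ℝ}
    (h : ∀ y ∈ Set.Icc ((N : ℝ) - 1) N, f y = g y) (hx : (N : ℝ) - 1 ≤ x) (hx' : x < N) :
    f =ᶠ[𝓝[≥] x] g := by
  filter_upwards [Icc_mem_nhdsGE hx'] with y hy
  exact h y ⟨hx.trans hy.1, hy.2⟩

theorem isJostSolution_exp_mul_mFun {α : ℤ → ℝ} {p : ℕ} (h : WeightSummable α p) (l : ℝ) :
    IsJostSolution α 1 l fun x => Complex.exp (Complex.I * l * x) * mFun α l x := by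
  set f : ℝ → ℂ := fun x => Complex.exp (Complex.I * l * x) * mFun α l x with hf
  have hpiece : ∀ N : ℤ, ∀ y ∈ Set.Icc ((N : ℝ) - 1) N, f y = jostPiece α l N y := fun N y hy =>
    exp_mul_mFun_eq_jostPiece h l hy
  have hpc : ∀ N : ℤ, Continuous (jostPiece α l N) := fun N =>
    continuous_iff_continuousAt.2 fun x => (hasDerivAt_jostPiece α l N x).continuousAt
  have hpc' : ∀ N : ℤ, Continuous (jostPieceDeriv α l N) := fun N =>
    continuous_iff_continuousAt.2 fun x => (hasDerivAt_jostPieceDeriv α l N x).continuousAt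
  have hnhds : ∀ N : ℤ, ∀ x ∈ Set.Ioo ((N : ℝ) - 1) N, f =ᶠ[𝓝 x] jostPiece α l N := by
    intro N x hx
    filter_upwards [Icc_mem_nhds hx.1 hx.2] with y hy
    exact hpiece N y hy
  have hderiv : ∀ N : ℤ, ∀ x ∈ Set.Ioo ((N : ℝ) - 1) N, HasDerivAt f (jostPieceDeriv α l N x) x :=
    fun N x hx => (hasDerivAt_jostPiece α l N x).congr_of_eventuallyEq (hnhds N x hx)
  have hoff : ∀ x : ℝ, x ∉ Set.range ((↑) : ℤ → ℝ) →
      x ∈ Set.Ioo (((⌊x⌋ + 1 : ℤ) : ℝ) - 1) (⌊x⌋ + 1 : ℤ) := by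
    intro x hx
    push_cast
    simpa using mem_Ioo_floor hx
  refine ⟨?_, fun x hx => (hderiv _ x (hoff x hx)).differentiableAt, fun x hx => ?_,
    fun n => ?_, ?_⟩
  -- The piece `⌈x⌉` gives left continuity and the piece `⌊x⌋ + 1` right continuity, at integers as
  -- well.
  · refine continuous_iff_continuousAt.2 fun x => continuousAt_iff_continuous_left_right.2 ⟨?_, ?_⟩
    · have hx1 : ((⌈x⌉ : ℤ) : ℝ) - 1 < x := by linarith [Int.ceil_lt_add_one x]
      have hx2 := Int.le_ceil x
      exact (hpc _).continuousWithinAt.congr_of_eventuallyEq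
        (eventuallyEq_nhdsLE (hpiece _) hx1 hx2) (hpiece _ x ⟨hx1.le, hx2⟩)
    · have hx1 : ((⌊x⌋ + 1 : ℤ) : ℝ) - 1 ≤ x := by push_cast; linarith [Int.floor_le x]
      have hx2 : x < (⌊x⌋ + 1 : ℤ) := by push_cast; exact Int.lt_floor_add_one x
      exact (hpc _).continuousWithinAt.congr_of_eventuallyEq
        (eventuallyEq_nhdsGE (hpiece _) hx1 hx2) (hpiece _ x ⟨hx1, hx2.le⟩)
  · have hx' := hoff x hx
    rw [hpiece _ x ⟨hx'.1.le, hx'.2.le⟩]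
    refine (hasDerivAt_jostPieceDeriv α l _ x).congr_of_eventuallyEq ?_
    filter_upwards [Ioo_mem_nhds hx'.1 hx'.2] with y hy
    exact (hderiv _ y hy).deriv
  · refine ⟨jostPieceDeriv α l n n, jostPieceDeriv α l (n + 1) n, ?_, ?_,
      (jostPieceDeriv_sub h l n).trans (by simp [hf])⟩
    · refine (((hpc' n).tendsto _).mono_left nhdsWithin_le_nhds).congr' ?_
      filter_upwards [Ioo_mem_nhdsLT (show (n : ℝ) - 1 < n by linarith)] with y hy
      exact (hderiv n y hy).deriv.symm
    · refine (((hpc' (n + 1)).tendsto _).mono_left nhdsWithin_le_nhds).congr' ?_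
      filter_upwards [Ioo_mem_nhdsGT (show (n : ℝ) < n + 1 by linarith)] with y hy
      exact (hderiv (n + 1) y (by push_cast; simpa using hy)).deriv.symm
  · rw [comap_one_mul_atTop, Asymptotics.IsEquivalent]
    -- `‖m - 1‖` is at most the majorant minus one, which tends to `0`.
    have hm : Tendsto (fun x => mFun α l x - 1) atTop (𝓝 0) :=
      squeeze_zero_norm (norm_mFun_sub_one_le h l) (by simpa using (tendsto_majorant h).sub_const 1)
    have h1 := (Asymptotics.isBigO_refl (fun x : ℝ => Complex.exp (Complex.I * (1 : ℝ) * l * x))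
      atTop).mul_isLittleO ((Asymptotics.isLittleO_one_iff ℂ).2 hm)
    simp only [mul_one] at h1
    refine h1.congr_left fun x => ?_
    simp only [hf, Pi.sub_apply, Complex.ofReal_one, mul_one]
    ring

theorem existsUnique_isJostSolution {α : ℤ → ℝ} {p : ℕ} (h : WeightSummable α p) (l : ℝ) :
    ∃! f : ℝ → ℂ, IsJostSolution α 1 l f :=
  ⟨_, isJostSolution_exp_mul_mFun h l, fun _ hg => hg.unique (isJostSolution_exp_mul_mFun h l)⟩

theorem mJost_eq_mFun {α : ℤ → ℝ} {p : ℕ} (h : WeightSummable α p) (l x : ℝ) :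
    mJost α 1 l x = mFun α l x := by
  have h1 : IsJostSolution α 1 l (jost α 1 l) :=
    Classical.epsilon_spec ⟨_, isJostSolution_exp_mul_mFun h l⟩
  rw [mJost, h1.unique (isJostSolution_exp_mul_mFun h l), ← mul_assoc, ← Complex.exp_add]
  simp

/-! ### The associated tempered distributions and their derivatives in `x` and `ξ` -/

/-- The tempered distribution encoded by `P`. -/
noncomputable def toDistribution (P : Measure (ℝ × ℂ)) : 𝓢'(ℝ, ℂ) :=
  Classical.epsilon fun T => ∀ φ : 𝓢(ℝ, ℂ), T φ = pairing P φ

theorem toDistribution_apply {p : ℕ} {P : Measure (ℝ × ℂ)} (h : mass p P ≠ ⊤) (φ : 𝓢(ℝ, ℂ)) :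
    toDistribution P φ = pairing P φ :=
  Classical.epsilon_spec (exists_distribution h) φ

theorem hasRep_toDistribution {p : ℕ} {P : Measure (ℝ × ℂ)} [hP : SFinite P] {C : ℝ≥0∞}
    (h : mass p P ≤ C) (hC : C ≠ ⊤) : HasRep p C (toDistribution P) :=
  ⟨P, hP, h, toDistribution_apply (ne_top_of_le_ne_top hC h)⟩

/-- Fubini; the sign in `character` is that of the inverse transform. -/
theorem isGivenBy_fourierInv_toDistribution {p : ℕ} {P : Measure (ℝ × ℂ)} [SFinite P]
    (h : mass p P ≠ ⊤) : IsGivenBy (𝓕⁻ (toDistribution P)) fun l => pairing P (character l) := by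
  intro φ
  have hint : Integrable (fun z : (ℝ × ℂ) × ℝ => (z.1.2 * φ z.2) * character z.2 z.1.1)
      (P.prod volume) :=
    ((integrable_snd_of_mass h).mul_prod φ.integrable).mul_bdd (c := 1)
      (Continuous.aestronglyMeasurable (by unfold character; fun_prop))
      (Eventually.of_forall fun z => (norm_character _ _).le)
  have heq : ∀ l : ℝ, ∫ q : ℝ × ℂ, (q.2 * φ l) * character l q.1 ∂P =
      pairing P (character l) * φ l := by
    intro l
    rw [pairing, ← integral_mul_const]
    refine integral_congr_ae (Eventually.of_forall fun q => ?_)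
    dsimp only
    ring
  constructor
  · exact hint.integral_prod_right.congr (Eventually.of_forall heq)
  · rw [TemperedDistribution.fourierInv_apply, toDistribution_apply h]
    simp_rw [← heq]
    rw [← integral_integral_swap hint]
    refine integral_congr_ae (Eventually.of_forall fun q => ?_)
    dsimp only
    rw [fourierInv_coe, Real.fourierInv_eq', ← integral_const_mul]
    refine integral_congr_ae (Eventually.of_forall fun l => ?_)
    simp only [character, smul_eq_mul]
    rw [mul_assoc q.2, mul_comm (φ l)]
    congr 3
    simp only [RCLike.inner_apply, conj_trivial]
    push_cast
    ring

theorem continuous_pairing_shift {p : ℕ} {P : Measure (ℝ × ℂ)} (h : mass p P ≠ ⊤)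
    (φ : 𝓢(ℝ, ℂ)) : Continuous fun r : ℝ => pairing P fun s => φ (r + s) := by
  refine continuous_of_dominated (bound := fun q => ‖q.2‖ * SchwartzMap.seminorm ℂ 0 0 φ)
    (fun r => Continuous.aestronglyMeasurable (by fun_prop)) (fun r => Eventually.of_forall
      fun q => ?_) ((integrable_snd_of_mass h).norm.mul_const _) (Eventually.of_forall fun q =>
        by fun_prop)
  rw [norm_mul]
  gcongr
  exact norm_le_seminorm ℂ φ _

theorem hasDerivAt_pairing_shift {p : ℕ} {P : Measure (ℝ × ℂ)} (h : mass p P ≠ ⊤)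
    (φ : 𝓢(ℝ, ℂ)) (r : ℝ) : HasDerivAt (fun r : ℝ => pairing P fun s => φ (r + s))
      (pairing P fun s => SchwartzMap.derivCLM ℂ ℂ φ (r + s)) r := by
  refine (hasDerivAt_integral_of_dominated_loc_of_deriv_le (s := Set.univ)
    (F := fun (r : ℝ) (q : ℝ × ℂ) => q.2 * φ (r + q.1))
    (F' := fun (r : ℝ) (q : ℝ × ℂ) => q.2 * SchwartzMap.derivCLM ℂ ℂ φ (r + q.1))
    (bound := fun q => ‖q.2‖ * SchwartzMap.seminorm ℂ 0 0 (SchwartzMap.derivCLM ℂ ℂ φ))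
    Filter.univ_mem (Eventually.of_forall fun r => Continuous.aestronglyMeasurable (by fun_prop))
    ?_ (Continuous.aestronglyMeasurable (by fun_prop)) (Eventually.of_forall fun q r _ => ?_)
    ((integrable_snd_of_mass h).norm.mul_const _) (Eventually.of_forall fun q r _ => ?_)).2
  · exact integrable_pairing h (φ := fun s => φ (r + s)) (by fun_prop)
      (fun s => norm_le_seminorm ℂ φ _)
  · rw [norm_mul]
    gcongr
    exact norm_le_seminorm ℂ _ _
  · exact ((φ.hasDerivAt (r + q.1)).comp_add_const r q.1).const_mul _

/-- The sum of the translates by `t n` of the complex measures encoded by `jostMeasure α n`, with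
the coefficients `c * α n`, over `n ≥ N`. -/
noncomputable def shiftSum (α : ℤ → ℝ) (N : ℤ) (c : ℝ) (t : ℤ → ℝ) : Measure (ℝ × ℂ) :=
  Measure.sum fun n : ℤ => mix (Measure.dirac (t n)) (fun _ => ((c * tail α N n : ℝ) : ℂ))
    (jostMeasure α n)

instance (α : ℤ → ℝ) (N : ℤ) (c : ℝ) (t : ℤ → ℝ) : SFinite (shiftSum α N c t) := by
  unfold shiftSum; infer_instance

/-- The bound for the weighted masses of the complex measures `shiftSum`. -/
noncomputable def shiftBound (α : ℤ → ℝ) (p : ℕ) (c x : ℝ) : ℝ :=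
  |c| * (1 + max (-x) 0) ^ p * majorant α p x * ∑' n : ℤ, |α n| * (1 + |(n : ℝ)|) ^ (p + 1)

theorem mass_shiftSum_le {α : ℤ → ℝ} {p : ℕ} (h : WeightSummable α p) {N : ℤ} (c : ℝ) {t : ℤ → ℝ}
    {x : ℝ} (hx : x ≤ N) (ht : ∀ n : ℤ, N ≤ n → |t n| ≤ n - x) :
    mass p (shiftSum α N c t) ≤ ENNReal.ofReal (shiftBound α p c x) := by
  have hW := (majorant_pos α p x).le
  rw [shiftSum, mass_sum, shiftBound, ← tsum_mul_left, ENNReal.ofReal_tsum_of_nonneg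
    (fun n => by positivity) (h.mul_left _)]
  refine ENNReal.tsum_le_tsum fun n => (mass_mix_le p measurable_const _).trans ?_
  rw [lintegral_dirac]
  rcases le_or_gt N n with hn | hn
  · have hn' : (N : ℝ) ≤ n := by exact_mod_cast hn
    -- The factor `1 + max (-x) 0` equals `1` for `x ≥ 0`, which makes the bound uniform there.
    have h1 : 1 + |t n| ≤ (1 + max (-x) 0) * (1 + |(n : ℝ)|) := by
      have := ht n hn
      nlinarith [le_max_left (-x) 0, le_max_right (-x) 0, le_abs_self (n : ℝ),
        mul_nonneg (le_max_right (-x) 0) (abs_nonneg (n : ℝ))]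
    calc ‖((c * tail α N n : ℝ) : ℂ)‖ₑ * (1 + ‖t n‖ₑ) ^ p * mass p (jostMeasure α n)
        ≤ ENNReal.ofReal (|c| * |α n|) * ENNReal.ofReal ((1 + |t n|) ^ p) *
            ENNReal.ofReal (majorant α p n) := by
          rw [tail_of_le hn, ← ofReal_norm, ← ofReal_norm, Complex.norm_real, norm_mul,
            ENNReal.ofReal_pow (by positivity), ENNReal.ofReal_add (by positivity) (by positivity),
            ENNReal.ofReal_one]
          simp only [Real.norm_eq_abs]
          gcongr
          exact mass_jostMeasure_le h n
      _ = ENNReal.ofReal (|c| * |α n| * (1 + |t n|) ^ p * majorant α p n) := by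
          rw [ENNReal.ofReal_mul (p := |c| * |α n| * (1 + |t n|) ^ p) (by positivity),
            ENNReal.ofReal_mul (p := |c| * |α n|) (by positivity)]
      _ ≤ _ := by
          refine ENNReal.ofReal_le_ofReal ?_
          have h2 : majorant α p n ≤ majorant α p x := majorant_anti h (hx.trans hn')
          have h3 := (majorant_pos α p n).le
          calc |c| * |α n| * (1 + |t n|) ^ p * majorant α p n
              ≤ |c| * |α n| * ((1 + max (-x) 0) * (1 + |(n : ℝ)|)) ^ p * majorant α p x := by
                gcongr
            _ = |c| * (1 + max (-x) 0) ^ p * majorant α p x *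
                  (|α n| * (1 + |(n : ℝ)|) ^ p) := by rw [mul_pow]; ring
            _ ≤ _ := by
                gcongr
                · linarith [abs_nonneg (n : ℝ)]
                · simp
  · simp [tail_of_lt hn]

theorem mass_shiftSum_ne_top {α : ℤ → ℝ} {p : ℕ} (h : WeightSummable α p) {N : ℤ} (c : ℝ)
    {t : ℤ → ℝ} {x : ℝ} (hx : x ≤ N) (ht : ∀ n : ℤ, N ≤ n → |t n| ≤ n - x) :
    mass p (shiftSum α N c t) ≠ ⊤ :=
  ne_top_of_le_ne_top ENNReal.ofReal_ne_top (mass_shiftSum_le h c hx ht)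

theorem hasSum_pairing_shiftSum {α : ℤ → ℝ} {p : ℕ} (h : WeightSummable α p) {N : ℤ} (c : ℝ)
    {t : ℤ → ℝ} {x : ℝ} (hx : x ≤ N) (ht : ∀ n : ℤ, N ≤ n → |t n| ≤ n - x) (φ : 𝓢(ℝ, ℂ)) :
    HasSum (fun n : ℤ => ((c * tail α N n : ℝ) : ℂ) *
      pairing (jostMeasure α n) fun s => φ (t n + s)) (pairing (shiftSum α N c t) φ) := by
  have hb := fun s => norm_le_seminorm ℂ φ s
  have h1 := hasSum_pairing (mass_shiftSum_ne_top h c hx ht) φ.continuous.measurable hb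
  rw [← shiftSum] at h1
  convert h1 using 2 with n
  rw [pairing_mix measurable_const (integrable_const _) (mass_jostMeasure_ne_top h n)
    φ.continuous.measurable hb, integral_dirac]

theorem shiftBound_le {α : ℤ → ℝ} {p : ℕ} (h : WeightSummable α p) {c x : ℝ} (hx : 0 ≤ x) :
    shiftBound α p c x ≤ shiftBound α p c 0 := by
  unfold shiftBound
  have h1 : max (-x) 0 = 0 := max_eq_right (by linarith)
  have h2 : 0 ≤ ∑' n : ℤ, |α n| * (1 + |(n : ℝ)|) ^ (p + 1) := tsum_nonneg fun n => by positivity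
  have h3 := majorant_anti h hx
  rw [h1, neg_zero, max_self]
  gcongr

theorem abs_div_pi_le {x : ℝ} {N n : ℤ} (hx : x ≤ N) (hn : N ≤ n) :
    |((n : ℝ) - x) / Real.pi| ≤ n - x := by
  have hn' : (N : ℝ) ≤ n := by exact_mod_cast hn
  rw [abs_of_nonneg (div_nonneg (by linarith) Real.pi_pos.le)]
  exact div_le_self (by linarith) (by linarith [Real.pi_gt_three])

theorem hasDerivAt_integral_pairing {α : ℤ → ℝ} {p : ℕ} (h : WeightSummable α p) (n : ℤ)
    (φ : 𝓢(ℝ, ℂ)) (a y : ℝ) :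
    HasDerivAt (fun y : ℝ => ((Real.pi * a : ℝ) : ℂ) * ∫ r in (0 : ℝ)..((n - y) / Real.pi),
        pairing (jostMeasure α n) fun s => φ (r + s))
      (((-1 * a : ℝ) : ℂ) * pairing (jostMeasure α n) fun s => φ ((n - y) / Real.pi + s)) y := by
  have hpi : (Real.pi : ℂ) ≠ 0 := by exact_mod_cast Real.pi_pos.ne'
  have hc := continuous_pairing_shift (mass_jostMeasure_ne_top h n) φ
  set G : ℝ → ℂ := fun r : ℝ => pairing (jostMeasure α n) fun s => φ (r + s)
  have h1 := intervalIntegral.integral_hasDerivAt_right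
    (hc.intervalIntegrable 0 (((n : ℝ) - y) / Real.pi))
    hc.stronglyMeasurable.stronglyMeasurableAtFilter hc.continuousAt
  have h2 : HasDerivAt (fun y : ℝ => ((n : ℝ) - y) / Real.pi) (-1 / Real.pi) y :=
    ((hasDerivAt_id y).const_sub (n : ℝ)).div_const Real.pi
  refine ((h1.scomp y h2).const_mul ((Real.pi * a : ℝ) : ℂ)).congr_deriv ?_
  change _ = ((-1 * a : ℝ) : ℂ) * G ((n - y) / Real.pi)
  rw [Complex.real_smul]
  push_cast
  field_simp

/-- Translation leaves the sup norm of `φ` unchanged, so the bound does not depend on `t` and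
dominates the termwise derivatives over the whole line. -/
theorem norm_tail_mul_pairing_le {α : ℤ → ℝ} {p : ℕ} (h : WeightSummable α p) (N n : ℤ)
    (φ : 𝓢(ℝ, ℂ)) (t : ℝ) :
    ‖((-1 * tail α N n : ℝ) : ℂ) * pairing (jostMeasure α n) fun s => φ (t + s)‖ ≤
      SchwartzMap.seminorm ℂ 0 0 φ * majorant α p N * (|α n| * (1 + |(n : ℝ)|) ^ (p + 1)) := by
  have hW := (majorant_pos α p N).le
  have hs : 0 ≤ SchwartzMap.seminorm ℂ 0 0 φ := apply_nonneg _ _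
  rcases le_or_gt N n with hn | hn
  · have h1 := norm_pairing_jostMeasure_le h n (φ := fun s => φ (t + s))
      (fun s => norm_le_seminorm ℂ φ _)
    have h2 : majorant α p n ≤ majorant α p N := majorant_anti h (by exact_mod_cast hn)
    rw [norm_mul, tail_of_le hn, Complex.norm_real, neg_one_mul, norm_neg, Real.norm_eq_abs]
    calc _ ≤ |α n| * (SchwartzMap.seminorm ℂ 0 0 φ * majorant α p N) := by
          gcongr
          exact h1.trans (by gcongr)
      _ = SchwartzMap.seminorm ℂ 0 0 φ * majorant α p N * (|α n| * 1) := by ring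
      _ ≤ _ := by
          gcongr
          exact one_le_pow₀ (by linarith [abs_nonneg (n : ℝ)])
  · simp only [tail_of_lt hn, mul_zero, Complex.ofReal_zero, zero_mul, norm_zero]
    positivity

/-- The smooth continuation of `x ↦ ⟨T_x, φ⟩` from `[N - 1, N]` is differentiable. -/
theorem hasDerivAt_tsum_tail {α : ℤ → ℝ} {p : ℕ} (h : WeightSummable α p) {N : ℤ} {x : ℝ}
    (hx : x ≤ N) (φ : 𝓢(ℝ, ℂ)) :
    HasDerivAt (fun y : ℝ => ∑' n : ℤ, ((Real.pi * tail α N n : ℝ) : ℂ) *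
      ∫ r in (0 : ℝ)..((n - y) / Real.pi), pairing (jostMeasure α n) fun s => φ (r + s))
      (pairing (shiftSum α N (-1) fun n => (n - x) / Real.pi) φ) x := by
  -- Termwise differentiation requires convergence at one point; `N` lies in the interval where the
  -- series represents the pairing.
  have h0 := (hasSum_pairing_scattered_tail h (N := N) (x := N) (by simp) φ.continuous.measurable
    (fun s => norm_le_seminorm ℂ φ s)).summable
  rw [← (hasSum_pairing_shiftSum h (-1) hx (fun n hn => abs_div_pi_le hx hn) φ).tsum_eq]
  exact hasDerivAt_tsum (h.mul_left (SchwartzMap.seminorm ℂ 0 0 φ * majorant α p N))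
    (fun n y => hasDerivAt_integral_pairing h n φ (tail α N n) y)
    (fun n y => norm_tail_mul_pairing_le h N n φ _) h0 x

theorem toDistribution_scattered_apply {α : ℤ → ℝ} {p : ℕ} (h : WeightSummable α p) {N : ℤ} {x : ℝ}
    (hx : x ∈ Set.Icc ((N : ℝ) - 1) N) (φ : 𝓢(ℝ, ℂ)) :
    toDistribution (scattered α x) φ = ∑' n : ℤ, ((Real.pi * tail α N n : ℝ) : ℂ) *
      ∫ r in (0 : ℝ)..((n - x) / Real.pi), pairing (jostMeasure α n) fun s => φ (r + s) := by
  rw [toDistribution_apply (mass_scattered_ne_top h x)]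
  exact (hasSum_pairing_scattered_tail h hx φ.continuous.measurable
    (fun s => norm_le_seminorm ℂ φ s)).tsum_eq.symm

/-- The one-sided derivative in `x`, from the interval `[N - 1, N]`. -/
noncomputable def paramDeriv (α : ℤ → ℝ) (N : ℤ) (x : ℝ) : 𝓢'(ℝ, ℂ) :=
  toDistribution (shiftSum α N (-1) fun n => (n - x) / Real.pi)

/-- Only the piece to the left of `x` is used, with its right endpoint allowed. At an integer `x`
this forces `N = x`, whereas the right derivative uses `N = x + 1`; the two differ by the term of
the site `x`. -/
theorem hasParamDerivWithin_Iic {α : ℤ → ℝ} {p : ℕ} (h : WeightSummable α p) {N : ℤ} {x : ℝ}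
    (hx : (N : ℝ) - 1 < x) (hx' : x ≤ N) :
    HasParamDerivWithin (fun x => toDistribution (scattered α x)) (paramDeriv α N x)
      (Set.Iic x) x := by
  intro φ
  rw [paramDeriv, toDistribution_apply
    (mass_shiftSum_ne_top h (-1) hx' fun n hn => abs_div_pi_le hx' hn)]
  refine (hasDerivAt_tsum_tail h hx' φ).hasDerivWithinAt.congr_of_eventuallyEq
    (eventuallyEq_nhdsLE (fun y hy => toDistribution_scattered_apply h hy φ) hx hx')
    (toDistribution_scattered_apply h ⟨hx.le, hx'⟩ φ)

theorem hasParamDerivWithin_Ici {α : ℤ → ℝ} {p : ℕ} (h : WeightSummable α p) {N : ℤ} {x : ℝ}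
    (hx : (N : ℝ) - 1 ≤ x) (hx' : x < N) :
    HasParamDerivWithin (fun x => toDistribution (scattered α x)) (paramDeriv α N x)
      (Set.Ici x) x := by
  intro φ
  rw [paramDeriv, toDistribution_apply
    (mass_shiftSum_ne_top h (-1) hx'.le fun n hn => abs_div_pi_le hx'.le hn)]
  refine (hasDerivAt_tsum_tail h hx'.le φ).hasDerivWithinAt.congr_of_eventuallyEq
    (eventuallyEq_nhdsGE (fun y hy => toDistribution_scattered_apply h hy φ) hx hx')
    (toDistribution_scattered_apply h ⟨hx, hx'.le⟩ φ)

/-- The distributional derivative of `1_{(0,t]}` is `δ₀ - δ_t`, convolved here with the measure of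
each site. -/
theorem derivCLM_toDistribution_scattered {α : ℤ → ℝ} {p : ℕ} (h : WeightSummable α p) {N : ℤ}
    {x : ℝ} (hx : x ∈ Set.Icc ((N : ℝ) - 1) N) :
    TemperedDistribution.derivCLM ℂ (toDistribution (scattered α x)) =
      toDistribution (shiftSum α N (-Real.pi) fun n => (n - x) / Real.pi) +
        toDistribution (shiftSum α N Real.pi fun _ => 0) := by
  ext φ
  have ht : ∀ n : ℤ, N ≤ n → |((n : ℝ) - x) / Real.pi| ≤ n - x := fun n hn =>
    abs_div_pi_le hx.2 hn
  have ht0 : ∀ n : ℤ, N ≤ n → |(fun _ : ℤ => (0 : ℝ)) n| ≤ n - x := fun n hn =>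
    le_trans (by simp) ((abs_nonneg _).trans (ht n hn))
  have h1 := hasSum_pairing_shiftSum h (-Real.pi) hx.2 ht φ
  have h2 := hasSum_pairing_shiftSum h Real.pi hx.2 ht0 φ
  have h3 := (h1.add h2).tsum_eq
  rw [TemperedDistribution.derivCLM_apply_apply, map_neg, toDistribution_scattered_apply h hx]
  change _ = toDistribution (shiftSum α N (-Real.pi) fun n => (n - x) / Real.pi) φ +
        toDistribution (shiftSum α N Real.pi fun _ => 0) φ
  rw [toDistribution_apply (mass_shiftSum_ne_top h _ hx.2 ht),
    toDistribution_apply (mass_shiftSum_ne_top h _ hx.2 ht0), ← h3, ← tsum_neg]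
  refine tsum_congr fun n => ?_
  rw [intervalIntegral.integral_eq_sub_of_hasDerivAt
    (f := fun r => pairing (jostMeasure α n) fun s => φ (r + s))
    (fun r _ => hasDerivAt_pairing_shift (mass_jostMeasure_ne_top h n) φ r)
    ((continuous_pairing_shift (mass_jostMeasure_ne_top h n) _).intervalIntegrable _ _)]
  push_cast
  ring

/-! ### Uniform bounds, stability under convolution and reflection -/

/-- The family `T` has the bounds of the main theorem, in terms of representing measures. -/
def HasBounds (ε : ℝ) (p : ℕ) (T : ℝ → 𝓢'(ℝ, ℂ)) : Prop :=
  ∃ C : ℝ≥0∞, C ≠ ⊤ ∧ (∀ x : ℝ, 0 ≤ ε * x → HasRep p C (T x)) ∧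
    (∃ Dl Dr : ℝ → 𝓢'(ℝ, ℂ),
      (∀ x : ℝ, 0 ≤ ε * x → HasParamDerivWithin T (Dl x) (Set.Iic x) x ∧
        HasParamDerivWithin T (Dr x) (Set.Ici x) x) ∧
      (∀ x : ℝ, 0 ≤ ε * x → x ∉ Set.range ((↑) : ℤ → ℝ) → Dl x = Dr x) ∧
      (∀ x : ℝ, 0 ≤ ε * x → HasRep p C (Dl x)) ∧ ∀ x : ℝ, 0 ≤ ε * x → HasRep p C (Dr x)) ∧
    ∀ x : ℝ, 0 ≤ ε * x → HasRep p C (TemperedDistribution.derivCLM ℂ (T x))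

theorem boundedTV_of_hasRep {ε : ℝ} {p : ℕ} {C : ℝ≥0∞} {T : ℝ → 𝓢'(ℝ, ℂ)} (hC : C ≠ ⊤)
    (h : ∀ x : ℝ, 0 ≤ ε * x → HasRep p C (T x)) : BoundedTV ε p T :=
  (iSup₂_le fun x hx => (h x hx).tvNorm_mulPow_le hC).trans_lt (lt_top_iff_ne_top.2 hC)

theorem HasBounds.bounded {ε : ℝ} {p : ℕ} {T : ℝ → 𝓢'(ℝ, ℂ)} (h : HasBounds ε p T) :
    BoundedTV ε p T ∧ BoundedTVDerivParam ε p T ∧ BoundedTVDeriv ε p T := by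
  obtain ⟨C, hC, h1, ⟨Dl, Dr, h2, h3, h4, h5⟩, h6⟩ := h
  exact ⟨boundedTV_of_hasRep hC h1, ⟨Dl, Dr, h2, h3, boundedTV_of_hasRep hC h4,
    boundedTV_of_hasRep hC h5⟩, boundedTV_of_hasRep hC h6⟩

theorem HasBounds.conv {ε : ℝ} {p : ℕ} {T : ℝ → 𝓢'(ℝ, ℂ)} (h : HasBounds ε p T) (g : 𝓢(ℝ, ℂ)) :
    HasBounds ε p fun x => conv g (T x) := by
  obtain ⟨C, hC, h1, ⟨Dl, Dr, h2, h3, h4, h5⟩, h6⟩ := h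
  -- The second summand serves `∂_ξ`, which falls on `g`. The derivative in `x` commutes with the
  -- convolution, since this only changes the test function.
  set K : ℝ≥0∞ := weightedNorm p g * C + weightedNorm p (SchwartzMap.derivCLM ℂ ℂ g) * C with hK
  have hconv : ∀ S : 𝓢'(ℝ, ℂ), HasRep p C S → HasRep p K (DeltaArray.conv g S) := fun S hS =>
    (hS.conv hC g).mono le_self_add
  refine ⟨K, ENNReal.add_ne_top.2 ⟨ENNReal.mul_ne_top (weightedNorm_ne_top _ _) hC,
    ENNReal.mul_ne_top (weightedNorm_ne_top _ _) hC⟩, fun x hx => hconv _ (h1 x hx),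
    ⟨fun x => DeltaArray.conv g (Dl x), fun x => DeltaArray.conv g (Dr x), fun x hx =>
      ⟨fun φ => (h2 x hx).1 _, fun φ => (h2 x hx).2 _⟩, fun x hx hx' => congrArg _ (h3 x hx hx'),
      fun x hx => hconv _ (h4 x hx), fun x hx => hconv _ (h5 x hx)⟩, fun x hx => ?_⟩
  rw [derivCLM_conv]
  exact ((h1 x hx).conv hC _).mono le_add_self

theorem HasBounds.reflect {p : ℕ} {T : ℝ → 𝓢'(ℝ, ℂ)} (h : HasBounds 1 p T) :
    HasBounds (-1) p fun x => T (-x) := by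
  obtain ⟨C, hC, h1, ⟨Dl, Dr, h2, h3, h4, h5⟩, h6⟩ := h
  have hs : ∀ x : ℝ, 0 ≤ -1 * x → 0 ≤ 1 * -x := fun x hx => by linarith
  have hneg : ∀ S : 𝓢'(ℝ, ℂ), HasRep p C S → HasRep p C (-S) := by
    rintro S ⟨P, hP, hm, hS⟩
    refine ⟨mix (Measure.dirac 0) (fun _ => -1) P, inferInstance,
      (mass_mix_le p measurable_const P).trans (by simpa using hm), fun φ => ?_⟩
    rw [pairing_mix measurable_const (integrable_const _) (ne_top_of_le_ne_top hC hm)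
      φ.continuous.measurable (fun s => norm_le_seminorm ℂ φ s), integral_dirac]
    simp [← hS]
  refine ⟨C, hC, fun x hx => h1 _ (hs x hx),
    -- Reflection in `x` exchanges the one-sided derivatives and changes their sign; `ξ` is not
    -- reflected.
    ⟨fun x => -Dr (-x), fun x => -Dl (-x), fun x hx => ⟨fun φ => ?_, fun φ => ?_⟩,
      fun x hx hx' => ?_, fun x hx => hneg _ (h5 _ (hs x hx)),
      fun x hx => hneg _ (h4 _ (hs x hx))⟩, fun x hx => h6 _ (hs x hx)⟩
  · have h7 := (h2 (-x) (hs x hx)).2 φ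
    have h8 := h7.scomp x (hasDerivWithinAt_neg x (Set.Iic x)) (fun y hy => by simpa using hy)
    simpa using! h8
  · have h7 := (h2 (-x) (hs x hx)).1 φ
    have h8 := h7.scomp x (hasDerivWithinAt_neg x (Set.Ici x)) (fun y hy => by simpa using hy)
    simpa using! h8
  · refine congrArg _ (h3 (-x) (hs x hx) ?_).symm
    rintro ⟨n, hn⟩
    exact hx' ⟨-n, by push_cast; rw [hn, neg_neg]⟩

theorem hasBounds_toDistribution_scattered {α : ℤ → ℝ} {p : ℕ} (h : WeightSummable α p) :
    HasBounds 1 p fun x => toDistribution (scattered α x) := by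
  set K : ℝ → ℝ≥0∞ := fun c => ENNReal.ofReal (shiftBound α p c 0) with hK
  set C : ℝ≥0∞ := ENNReal.ofReal (majorant α p 0) + K (-1) + (K (-Real.pi) + K Real.pi) with hC
  have hCtop : C ≠ ⊤ := by simp [hC, hK]
  have hshift : ∀ (c x : ℝ) (N : ℤ) (t : ℤ → ℝ), 0 ≤ 1 * x → x ≤ N →
      (∀ n : ℤ, N ≤ n → |t n| ≤ n - x) → HasRep p (K c) (toDistribution (shiftSum α N c t)) := by
    intro c x N t hx hN ht
    refine hasRep_toDistribution ((mass_shiftSum_le h c hN ht).trans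
      (ENNReal.ofReal_le_ofReal (shiftBound_le h (by linarith)))) ENNReal.ofReal_ne_top
  have hparam : ∀ (x : ℝ) (N : ℤ), 0 ≤ 1 * x → x ≤ N → HasRep p C (paramDeriv α N x) :=
    fun x N hx hN => (hshift (-1) x N _ hx hN fun n hn => abs_div_pi_le hN hn).mono
      (le_add_self.trans le_self_add)
  have hceil : ∀ x : ℝ, ((⌈x⌉ : ℤ) : ℝ) - 1 < x := fun x => by linarith [Int.ceil_lt_add_one x]
  have hfloor : ∀ x : ℝ, x < (⌊x⌋ + 1 : ℤ) := fun x => by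
    push_cast; exact Int.lt_floor_add_one x
  refine ⟨C, hCtop, fun x hx => ?_, ⟨fun x => paramDeriv α ⌈x⌉ x,
    fun x => paramDeriv α (⌊x⌋ + 1) x, fun x hx => ⟨?_, ?_⟩, fun x hx hx' => ?_,
    fun x hx => hparam x _ hx (Int.le_ceil x), fun x hx => hparam x _ hx (hfloor x).le⟩,
    fun x hx => ?_⟩
  · refine hasRep_toDistribution (le_trans ?_ (le_self_add.trans le_self_add)) hCtop
    calc mass p (scattered α x) ≤ mass p (jostMeasure α x) := by
          rw [← one_add_mass_scattered]; exact le_add_self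
      _ ≤ ENNReal.ofReal (majorant α p x) := mass_jostMeasure_le h x
      _ ≤ _ := ENNReal.ofReal_le_ofReal (majorant_anti h (by linarith))
  · exact hasParamDerivWithin_Iic h (hceil x) (Int.le_ceil x)
  · exact hasParamDerivWithin_Ici h (by push_cast; linarith [Int.floor_le x]) (hfloor x)
  · have : ⌈x⌉ = ⌊x⌋ + 1 := by
      have h1 := mem_Ioo_floor hx'
      rw [Int.ceil_eq_iff]
      push_cast
      exact ⟨by linarith [h1.1], h1.2.le⟩
    dsimp only
    rw [this]
  · rw [derivCLM_toDistribution_scattered h ⟨(hceil x).le, Int.le_ceil x⟩]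
    refine ((hshift (-Real.pi) x ⌈x⌉ _ hx (Int.le_ceil x)
      fun n hn => abs_div_pi_le (Int.le_ceil x) hn).add
      (hshift Real.pi x ⌈x⌉ _ hx (Int.le_ceil x) fun n hn => ?_) ENNReal.ofReal_ne_top
        ENNReal.ofReal_ne_top).mono le_add_self
    exact le_trans (by simp) ((abs_nonneg _).trans (abs_div_pi_le (Int.le_ceil x) hn))

/-! ### The weight hypothesis and the reduction of `f₋` to `f₊` -/

theorem weightSummable_of_memWeightedL1 {α : ℤ → ℝ} {p : ℕ}
    (h : MemWeightedL1 ((p + 1 : ℕ) : ℝ) α) : WeightSummable α p := by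
  have h1 : Summable fun n : ℤ => |(n : ℝ)| ^ (p + 1) * |α n| := by
    simpa only [MemWeightedL1, Real.rpow_natCast] using h
  -- The weight `|n|^(p+1)` vanishes at `n = 0`, so `α 0` is added by hand; elsewhere `1 + |n| ≤
  -- 2|n|`.
  have h2 : Summable fun n : ℤ => (2 : ℝ) ^ (p + 1) * (|(n : ℝ)| ^ (p + 1) * |α n|) +
      (if n = 0 then |α 0| else 0) :=
    (h1.mul_left _).add ((hasSum_ite_eq (0 : ℤ) |α 0|).summable)
  refine Summable.of_nonneg_of_le (fun n => by positivity) (fun n => ?_) h2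
  by_cases hn : n = 0
  · simp [hn]
  · have h3 : (1 : ℝ) ≤ |(n : ℝ)| := by exact_mod_cast Int.one_le_abs hn
    rw [if_neg hn, add_zero]
    calc |α n| * (1 + |(n : ℝ)|) ^ (p + 1) ≤ |α n| * (2 * |(n : ℝ)|) ^ (p + 1) := by
          gcongr; linarith
      _ = _ := by rw [mul_pow]; ring

theorem WeightSummable.comp_neg {α : ℤ → ℝ} {p : ℕ} (h : WeightSummable α p) :
    WeightSummable (fun n => α (-n)) p := by
  have := (Equiv.neg ℤ).summable_iff.2 h
  simpa [WeightSummable, Function.comp_def] using this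

/-- Reflection negates the derivative and exchanges its one-sided limits, so the jump keeps its
sign. -/
theorem IsJostSolution.reflect {α : ℤ → ℝ} {ε : ℝ} {z : ℂ} {f : ℝ → ℂ}
    (h : IsJostSolution α ε z f) :
    IsJostSolution (fun n => α (-n)) (-ε) z fun x => f (-x) := by
  have hmem : ∀ x : ℝ, x ∉ Set.range ((↑) : ℤ → ℝ) → -x ∉ Set.range ((↑) : ℤ → ℝ) := by
    rintro x hx ⟨n, hn⟩
    exact hx ⟨-n, by push_cast; rw [hn, neg_neg]⟩
  have hderiv : deriv (fun x => f (-x)) = fun x => -deriv f (-x) := by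
    ext x
    exact deriv_comp_neg f x
  refine ⟨h.continuous.comp continuous_neg, fun x hx => ?_, fun x hx => ?_, fun n => ?_, ?_⟩
  · exact (h.differentiableAt _ (hmem x hx)).comp x differentiableAt_id.neg
  · rw [hderiv]
    have h1 := (h.equation (-x) (hmem x hx)).scomp x (hasDerivAt_neg x)
    refine h1.neg.congr_deriv ?_
    simp
  · obtain ⟨dl, dr, hl, hr, hd⟩ := h.jump (-n)
    push_cast at hl hr hd
    refine ⟨-dr, -dl, ?_, ?_, ?_⟩
    · rw [hderiv]
      exact (hr.comp (by simpa using! (tendsto_neg_nhdsLT (a := (n : ℝ))))).neg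
    · rw [hderiv]
      exact (hl.comp (by simpa using! (tendsto_neg_nhdsGT (a := (n : ℝ))))).neg
    · rw [← hd]
      ring
  · have h1 := h.asymptotic.comp_tendsto (k := fun x : ℝ => -x)
      (l := comap (fun x : ℝ => -ε * x) atTop) (by
        rw [tendsto_comap_iff]
        refine tendsto_comap.congr fun x => ?_
        simp)
    refine h1.congr_right (Eventually.of_forall fun x => ?_)
    simp

theorem isJostSolution_reflect_iff {α : ℤ → ℝ} {z : ℂ} {f : ℝ → ℂ} :
    IsJostSolution α (-1) z f ↔ IsJostSolution (fun n => α (-n)) 1 z fun x => f (-x) := by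
  constructor
  · intro h
    simpa using h.reflect
  · intro h
    simpa using h.reflect

theorem existsUnique_isJostSolution_neg {α : ℤ → ℝ} {p : ℕ} (h : WeightSummable α p) (l : ℝ) :
    ∃! f : ℝ → ℂ, IsJostSolution α (-1) l f := by
  obtain ⟨f, hf, hu⟩ := existsUnique_isJostSolution h.comp_neg l
  refine ⟨fun x => f (-x), isJostSolution_reflect_iff.2 (by simpa using hf), fun g hg => ?_⟩
  have := hu _ (isJostSolution_reflect_iff.1 hg)
  ext x
  simp [← this]

/-- `jost` is a choice, so uniqueness is what identifies the two chosen solutions. -/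
theorem mJost_neg_eq {α : ℤ → ℝ} {p : ℕ} (h : WeightSummable α p) (l x : ℝ) :
    mJost α (-1) l x = mJost (fun n => α (-n)) 1 l (-x) := by
  have h1 : IsJostSolution α (-1) l (jost α (-1) l) :=
    Classical.epsilon_spec (existsUnique_isJostSolution_neg h l).exists
  have h2 : IsJostSolution (fun n => α (-n)) 1 l (jost (fun n => α (-n)) 1 l) :=
    Classical.epsilon_spec (existsUnique_isJostSolution h.comp_neg l).exists
  have h3 := (isJostSolution_reflect_iff.1 h1).unique h2
  rw [mJost, mJost, ← h3]
  dsimp only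
  rw [neg_neg]
  congr 2
  push_cast
  ring

theorem exists_distribution_mJost_one {α : ℤ → ℝ} {p : ℕ} (h : WeightSummable α p) :
    ∃ U : ℝ → 𝓢'(ℝ, ℂ), (∀ x : ℝ, IsGivenBy (U x) fun l : ℝ => mJost α 1 (l : ℂ) x - 1) ∧
      HasBounds 1 p fun x => 𝓕 (U x) := by
  -- Starting from the measure and taking `U` as its inverse transform makes `𝓕 (U x)` the measure
  -- by inversion; what remains is that `U` is given by `m - 1`.
  refine ⟨fun x => 𝓕⁻ (toDistribution (scattered α x)), fun x => ?_, ?_⟩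
  · have h1 := isGivenBy_fourierInv_toDistribution (mass_scattered_ne_top h x)
    convert h1 using 2 with l
    rw [mJost_eq_mFun h, mFun_eq h, add_sub_cancel_left]
  · simpa only [FourierTransform.fourier_fourierInv_eq] using hasBounds_toDistribution_scattered h

theorem exists_distribution_mJost {α : ℤ → ℝ} {p : ℕ} (h : WeightSummable α p) {ε : ℝ}
    (hε : ε = 1 ∨ ε = -1) :
    ∃ U : ℝ → 𝓢'(ℝ, ℂ), (∀ x : ℝ, IsGivenBy (U x) fun l : ℝ => mJost α ε (l : ℂ) x - 1) ∧
      HasBounds ε p fun x => 𝓕 (U x) := by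
  rcases hε with rfl | rfl
  · exact exists_distribution_mJost_one h
  · obtain ⟨U, hU, hb⟩ := exists_distribution_mJost_one h.comp_neg
    refine ⟨fun x => U (-x), fun x => ?_, hb.reflect⟩
    simpa only [mJost_neg_eq h] using hU (-x)

end DeltaArray

theorem lemma5p5 (j : ℕ) (hj : j = 1 ∨ j = 2) (α : ℤ → ℝ)
    (hα : DeltaArray.MemWeightedL1 (j : ℝ) α) (ε : ℝ) (hε : ε = 1 ∨ ε = -1) :
    (∀ l : ℝ, ∃! f : ℝ → ℂ, DeltaArray.IsJostSolution α ε (l : ℂ) f) ∧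
    ∃ U : ℝ → 𝓢'(ℝ, ℂ),
      (∀ x : ℝ, DeltaArray.IsGivenBy (U x) fun l : ℝ => DeltaArray.mJost α ε (l : ℂ) x - 1) ∧
      DeltaArray.BoundedTV ε (j - 1) (fun x => 𝓕 (U x)) ∧
      DeltaArray.BoundedTVDerivParam ε (j - 1) (fun x => 𝓕 (U x)) ∧
      DeltaArray.BoundedTVDeriv ε (j - 1) (fun x => 𝓕 (U x)) ∧
      ∀ (χ : ℝ → ℂ) (hχc : HasCompactSupport χ) (hχ : ContDiff ℝ ∞ χ),
        DeltaArray.BoundedTV ε (j - 1)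
          (fun x => DeltaArray.conv (𝓕 (hχc.toSchwartzMap hχ)) (𝓕 (U x))) ∧
        DeltaArray.BoundedTVDerivParam ε (j - 1)
          (fun x => DeltaArray.conv (𝓕 (hχc.toSchwartzMap hχ)) (𝓕 (U x))) ∧
        DeltaArray.BoundedTVDeriv ε (j - 1)
          (fun x => DeltaArray.conv (𝓕 (hχc.toSchwartzMap hχ)) (𝓕 (U x))) := by

  obtain ⟨p, rfl⟩ : ∃ p, j = p + 1 := ⟨j - 1, by omega⟩
  rw [Nat.add_sub_cancel]
  have h := DeltaArray.weightSummable_of_memWeightedL1 hα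
  refine ⟨fun l => ?_, ?_⟩
  · rcases hε with rfl | rfl
    · exact DeltaArray.existsUnique_isJostSolution h l
    · exact DeltaArray.existsUnique_isJostSolution_neg h l
  · obtain ⟨U, hU, hb⟩ := DeltaArray.exists_distribution_mJost h hε
    exact ⟨U, hU, hb.bounded.1, hb.bounded.2.1, hb.bounded.2.2,
      fun χ hχc hχ => (hb.conv (𝓕 (hχc.toSchwartzMap hχ))).bounded⟩
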